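/- **Theorem (Euler scheme, contractive case).** Let $b:\mathbb R^d\to\mathbb R^d$, and let $J\in[0,\infty)$ and $K,L,\mathcal R\in(0,\infty)$ be such that for all $x,y\in\mathbb R^d$ - (C1) $(x-y)\cdot(b(x)-b(y))\le J|x-y|^2$; - (C2) $(x-y)\cdot(b(x)-b(y))\le -K|x-y|^2$ if $|x-y|\ge\mathcal R$; - (C3) $|b(x)-b(y)|\le L|x-y|$. Let $h>0$ be the step size, write $\hat x=x+hb(x)$, and assume $|\hat x-\hat y|\le|x-y|$ for all $x,y\in\mathbb R^d$. *Coupling.* Let $Z\sim N(0,I_d)$ and $U\sim\mathrm{Unif}(0,1)$ be independent. For $x,y\in\mathbb R^d$ let $\hat e=(\hat x-\hat y)/|\hat x-\hat y|$ if $\hat x\ne\hat y$ and $\hat e=0$ otherwise. Let $X'=\hat x+\sqrt h\,Z$, and let $Y'=X'$ if $U\le\phi_{\hat y,hI}(X')/\phi_{\hat x,hI}(X')$ and $Y'=\hat y+\sqrt h\,(I_d-2\hat e\hat e^T)Z$ otherwise, where $\phi_{m,hI}$ is the density of $N(m,hI_d)$. Write $\mathbb E_{x,y}$ for expectations of functions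 of $(X',Y')$. *Constants.* With $\varphi(u)=(2\pi)^{-1/2}e^{-u^2/2}$, let $$c_0=4\min\Big(\int_0^{1/2}u^2(1-e^{u-1/2})\varphi(u)\,du,\ (1-e^{-1})\int_0^{1/2}u^3\varphi(u)\,du\Big),\qquad p_0=\int_1^\infty\varphi(u)\,du .$$ *Metric.* Suppose that $a=0$ or $a\ge\sqrt h$, and let $\underline\alpha(u)=c_0\min(u,\sqrt h)\sqrt h$. If $a=0$, let $I_r=(0,r+\sqrt h)$ for $r<\sqrt h$, $I_r=(r-\sqrt h,r)$ for $r\ge\sqrt h$, and $\hat I_s=\{r>0:s\in I_r\}$. If $a>0$, let $I_r=((r-\sqrt h)^+,r)$ and $\hat I_s=\{r>\sqrt h:s\in I_r\}$. Let $$g_a(u)=1-2c\int_0^u\sup_{v\in\hat I_s}\frac{a+v}{\underline\alpha(v)}\,ds,$$ where $c=\frac14\big(\int_0^{\mathcal R}\sup_{v\in\hat I_s}\frac{v}{\underline\alpha(v)}ds\big)^{-1}$ if $a=0$, and $c=\min\big(\frac{p_0}2,\frac14\big(\int_0^{\mathcal R}\sup_{v\in\hat I_s}\frac{a+v}{\underline\alpha(v)}ds\big)^{-1}\big)$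 if $a>0$. Let $$\rho_a(x,y)=a\mathbf 1_{x\ne y}+f_a(|x-y|),\qquad f_a(r)=\int_0^r g_a(s\wedge\mathcal R)\,ds .$$ *Conclusion.* One has $g_a(0)=1$, $g_a(s)\in[\frac12,1]$ for all $s\in[0,\mathcal R]$, and $$a\mathbf 1_{x\ne y}+\tfrac12|x-y|\le\rho_a(x,y)\le a\mathbf 1_{x\ne y}+|x-y|\qquad\text{for all }x,y\in\mathbb R^d .$$ If moreover $h<h_0:=\frac1L\min\big(\frac KL,\frac12\big)$, then $\rho_a(X',Y')$ is integrable and $$\mathbb E_{x,y}[\rho_a(X',Y')]\le(1-c_1(a)h)\,\rho_a(x,y)\qquad\text{for all }x,y\in\mathbb R^d,$$ where $$c_1(0)=\frac14\min\Big(K,\frac{2c_0}{\mathcal R^2+2\sqrt h\,\mathcal R+12h}\Big),\qquad c_1(a)=\frac14\min\Big(\frac K{1+a/\mathcal R},\frac{2c_0}{\mathcal R^2+2(a+\sqrt h)\mathcal R},\frac{2p_0}h\Big)\quad(a>0).$$ In particular, neither the constants $c_0,p_0$ nor the formula for $c_1(a)$ involves the dimension $d$. -/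

import Mathlib

open MeasureTheory ProbabilityTheory

noncomputable section

namespace EulerScheme

/-- The state space `ℝ^d` with its Euclidean norm. -/
abbrev E (d : ℕ) : Type := EuclideanSpace ℝ (Fin d)

/-- The deterministic part `x̂ = x + h b(x)` of an Euler step. -/
def hat {d : ℕ} (b : E d → E d) (h : ℝ) (x : E d) : E d := x + h • b x

/-- The density of `N(m, h I_d)` at `z`. -/
def gaussianDensity {d : ℕ} (m : E d) (h : ℝ) (z : E d) : ℝ :=
  (2 * Real.pi * h) ^ (-(d : ℝ) / 2) * Real.exp (-(1 / (2 * h)) * ‖z - m‖ ^ 2)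

/-- The unit vector `ê` from `ŷ` to `x̂`; it is the zero vector when `x̂ = ŷ`. -/
def unitDir {d : ℕ} (b : E d → E d) (h : ℝ) (x y : E d) : E d :=
  ‖hat b h x - hat b h y‖⁻¹ • (hat b h x - hat b h y)

/-- `X' = x̂ + √h z`, where `z` is the value of the Gaussian noise. -/
def stepX {d : ℕ} (b : E d → E d) (h : ℝ) (x z : E d) : E d :=
  hat b h x + √h • z

/-- `Y'_refl = ŷ + √h (I - 2 ê êᵀ) z`. -/
def stepRefl {d : ℕ} (b : E d → E d) (h : ℝ) (x y z : E d) : E d :=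
  hat b h y + √h • (z - (2 * inner ℝ (unitDir b h x y) z) • unitDir b h x y)

/-- `Y'` in the coupling of the transitions from `x` and `y`: it equals `X'` if
`u ≤ φ_{ŷ,hI}(X') / φ_{x̂,hI}(X')` and `Y'_refl` otherwise. Here `z` and `u` are the values
of the Gaussian and of the uniform random variable. -/
def stepY {d : ℕ} (b : E d → E d) (h : ℝ) (x y z : E d) (u : ℝ) : E d :=
  if u ≤ gaussianDensity (hat b h y) h (stepX b h x z) /
      gaussianDensity (hat b h x) h (stepX b h x z) then
    stepX b h x z
  else
    stepRefl b h x y z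

/-- The density of the standard normal distribution on `ℝ`. -/
def stdNormalDensity (u : ℝ) : ℝ := (√(2 * Real.pi))⁻¹ * Real.exp (-u ^ 2 / 2)

/-- The universal constant `c₀`. -/
def c₀ : ℝ :=
  4 * min (∫ u in (0 : ℝ)..(1 / 2), u ^ 2 * (1 - Real.exp (u - 1 / 2)) * stdNormalDensity u)
    ((1 - Real.exp (-1)) * ∫ u in (0 : ℝ)..(1 / 2), u ^ 3 * stdNormalDensity u)

/-- The universal constant `p₀`. -/
def p₀ : ℝ := ∫ u in Set.Ioi (1 : ℝ), stdNormalDensity u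

/-- The lower bound `c₀ min(r, √h) √h` for the distance-decreasing fluctuations. -/
def alphaLower (h r : ℝ) : ℝ := c₀ * min r (√h) * √h

/-- For `a = 0`: `I_r = (0, r + √h)` if `r < √h` and `I_r = (r - √h, r)` if `r ≥ √h`.
For `a ≠ 0`: `I_r = ((r - √h)⁺, r)`. -/
def interval (a h r : ℝ) : Set ℝ :=
  if a = 0 then
    if r < √h then Set.Ioo 0 (r + √h) else Set.Ioo (r - √h) r
  else
    Set.Ioo (max (r - √h) 0) r

/-- The dual intervals: `Î_s = {r > 0 : s ∈ I_r}` for `a = 0`, and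
`Î_s = {r > √h : s ∈ I_r}` for `a ≠ 0`. -/
def dualInterval (a h s : ℝ) : Set ℝ :=
  {r | (if a = 0 then 0 else √h) < r ∧ s ∈ interval a h r}

/-- `sup_{u ∈ Î_s} (a + Φ(u)) / α(u)` with `Φ(u) = u` and `α` the lower bound above. -/
def supRatio (a h s : ℝ) : ℝ :=
  sSup ((fun u : ℝ => (a + u) / alphaLower h u) '' dualInterval a h s)

/-- The constant `c` that enters the definition of `g_a`. -/
def metricConst (R h a : ℝ) : ℝ :=
  if a = 0 then 1 / 4 * (∫ s in (0 : ℝ)..R, supRatio a h s)⁻¹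
  else min (p₀ / 2) (1 / 4 * (∫ s in (0 : ℝ)..R, supRatio a h s)⁻¹)

/-- The function `g_a`. -/
def g (R h a u : ℝ) : ℝ :=
  1 - 2 * metricConst R h a * ∫ s in (0 : ℝ)..u, supRatio a h s

/-- `f_a(r) = ∫₀^r g_a(s ∧ R) ds`. -/
def f (R h a r : ℝ) : ℝ := ∫ s in (0 : ℝ)..r, g R h a (min s R)

open Classical in
/-- `a 1_{x ≠ y}`. -/
def jump {d : ℕ} (a : ℝ) (x y : E d) : ℝ := if x ≠ y then a else 0

/-- The metric `ρ_a(x, y) = a 1_{x ≠ y} + f_a(|x - y|)`. -/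
def rho {d : ℕ} (R h a : ℝ) (x y : E d) : ℝ := jump a x y + f R h a ‖x - y‖

/-- The contraction rate `c₁(a)`. -/
def c₁ (K R h a : ℝ) : ℝ :=
  if a = 0 then
    1 / 4 * min K (2 * c₀ / (R ^ 2 + 2 * √h * R + 12 * h))
  else
    1 / 4 * min (K / (1 + a / R)) (min (2 * c₀ / (R ^ 2 + 2 * (a + √h) * R)) (2 * p₀ / h))

end EulerScheme

end

noncomputable section

namespace EulerScheme

/-! Under reflection the noise orthogonal to `ê` cancels in `X' - Y'`, so the problem reduces to one
Gaussian variable `z` along `ê`. With `t = |x̂ - ŷ|` and `σ = √h`, the copies fail to merge with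
conditional probability `rejProb (t/σ) z`, and then end at distance `|t + 2σz|`
(`integrable_rho_step`). Reflecting `z` about `-t/(2σ)` shows that the mean new distance is again
`t` (`integral_rejProb_mul_dist`). Since `f_a` is concave, its tangent at `t` gives `E f_a ≤
f_a(t)`, and the defect of the tangent measures the gain (`integral_rejProb_mul_profile_le`).

The supremum in `g_a` equals `(a + s + √h)/(c₀h)` (`supRatio_eq`), so `f_a` is a cubic up to `R` and
affine beyond. For `t ≤ R` the gain suffices (`integral_rejProb_mul_le_of_lt`). If `t ≥ σ`, it comes
from small inward moves. If `t < σ` and `a > 0`, it is the mass `a` saved by merging. If `t < σ` and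
`a = 0`, it comes from small outward moves or, near `R`, from jumps past `R` or from merging. At
distances `r ≥ R` the drift gives `t ≤ (1 - hK/2) r` (`norm_hat_sub_le`), and the slope of `f_a`, at
least `1/2`, turns this into contraction. -/

/-! ### Gaussian integrals and the universal constants -/

lemma stdNormalDensity_eq_gaussianPDFReal : stdNormalDensity = gaussianPDFReal 0 1 := by
  ext u
  simp [stdNormalDensity, gaussianPDFReal]

lemma stdNormalDensity_pos (u : ℝ) : 0 < stdNormalDensity u := by
  unfold stdNormalDensity; positivity

@[fun_prop]
lemma continuous_stdNormalDensity : Continuous stdNormalDensity := by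
  unfold stdNormalDensity; fun_prop

lemma stdNormalDensity_neg (u : ℝ) : stdNormalDensity (-u) = stdNormalDensity u := by
  simp [stdNormalDensity]

lemma integrable_stdNormalDensity : Integrable stdNormalDensity := by
  rw [stdNormalDensity_eq_gaussianPDFReal]; exact integrable_gaussianPDFReal 0 1

lemma integral_gaussianReal_eq (k : ℝ → ℝ) :
    ∫ z, k z ∂(gaussianReal 0 1) = ∫ z, stdNormalDensity z * k z := by
  rw [integral_gaussianReal_eq_integral_smul one_ne_zero, stdNormalDensity_eq_gaussianPDFReal]
  rfl

lemma integrable_gaussianReal_iff (k : ℝ → ℝ) :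
    Integrable k (gaussianReal 0 1) ↔ Integrable (fun z => stdNormalDensity z * k z) := by
  rw [gaussianReal_of_var_ne_zero 0 one_ne_zero,
    integrable_withDensity_iff_integrable_smul' (measurable_gaussianPDF 0 1)
      (Filter.Eventually.of_forall fun _ => gaussianPDF_lt_top)]
  simp [toReal_gaussianPDF, stdNormalDensity_eq_gaussianPDFReal]

lemma integral_indicator_Ioc_gaussianReal {l u : ℝ} (hlu : l ≤ u) (k : ℝ → ℝ) :
    ∫ z, (Set.Ioc l u).indicator k z ∂(gaussianReal 0 1)
      = ∫ z in l..u, k z * stdNormalDensity z := by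
  rw [integral_gaussianReal_eq, intervalIntegral.integral_of_le hlu,
    ← integral_indicator measurableSet_Ioc]
  congr 1 with z
  by_cases hz : z ∈ Set.Ioc l u <;> simp [hz, mul_comm]

lemma gaussianReal_real_Ioi_one : (gaussianReal 0 1).real (Set.Ioi 1) = p₀ := by
  rw [Measure.real, gaussianReal_apply_eq_integral 0 one_ne_zero,
    ENNReal.toReal_ofReal (integral_nonneg fun x => gaussianPDFReal_nonneg _ _ _), p₀,
    stdNormalDensity_eq_gaussianPDFReal]

lemma gaussianReal_real_Iio_neg_one : (gaussianReal 0 1).real (Set.Iio (-1)) = p₀ := by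
  rw [← gaussianReal_real_Ioi_one]
  have h := gaussianReal_map_neg (μ := 0) (v := 1)
  rw [neg_zero] at h
  conv_lhs => rw [← h]
  rw [map_measureReal_apply measurable_neg measurableSet_Iio]
  congr 1
  ext z; simp

lemma p₀_le_one : p₀ ≤ 1 := by
  rw [← gaussianReal_real_Ioi_one]; exact measureReal_le_one

/-- On `[1, 2]` the density is at least `e⁻² φ(0) ≥ φ(0)/16`. This crude bound serves to compare
`p₀` with `c₀`. -/
lemma stdNormalDensity_zero_div_le_p₀ : stdNormalDensity 0 / 16 ≤ p₀ := by
  have h1 : ∫ u in (1 : ℝ)..2, stdNormalDensity u ≤ p₀ := by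
    rw [intervalIntegral.integral_of_le (by norm_num), p₀]
    exact setIntegral_mono_set integrable_stdNormalDensity.integrableOn
      (Filter.Eventually.of_forall fun u => (stdNormalDensity_pos u).le)
      (Filter.Eventually.of_forall Set.Ioc_subset_Ioi_self)
  have h2 : ∫ _ in (1 : ℝ)..2, stdNormalDensity 0 / 16 ≤ ∫ u in (1 : ℝ)..2, stdNormalDensity u := by
    apply intervalIntegral.integral_mono_on (by norm_num) (by simp)
      (continuous_stdNormalDensity.intervalIntegrable _ _)
    intro u hu
    have he : (1 / 16 : ℝ) ≤ Real.exp (-u ^ 2 / 2) := by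
      have h3 : Real.exp (-2) ≤ Real.exp (-u ^ 2 / 2) :=
        Real.exp_le_exp.2 (by nlinarith [hu.1, hu.2])
      have h4 : Real.exp (-2) = (Real.exp 1 ^ 2)⁻¹ := by
        rw [Real.exp_neg, ← Real.exp_nat_mul]; norm_num
      have h5 : Real.exp 1 ^ 2 ≤ 16 := by nlinarith [Real.exp_one_lt_d9, Real.exp_pos 1]
      have h6 : (16 : ℝ)⁻¹ ≤ (Real.exp 1 ^ 2)⁻¹ := inv_anti₀ (by positivity) h5
      rw [h4] at h3
      linarith
    unfold stdNormalDensity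
    have : 0 < (√(2 * Real.pi))⁻¹ := by positivity
    have : Real.exp (-(0 : ℝ) ^ 2 / 2) = 1 := by simp
    rw [this]
    nlinarith
  simp at h2
  linarith

lemma p₀_pos : 0 < p₀ :=
  lt_of_lt_of_le (by have := stdNormalDensity_pos 0; positivity)
    stdNormalDensity_zero_div_le_p₀

lemma one_sub_exp_neg_one_pos : 0 < 1 - Real.exp (-1) := by
  have : Real.exp (-1) < 1 := by simp
  linarith

lemma half_le_one_sub_exp_neg_one : 1 / 2 ≤ 1 - Real.exp (-1) := by
  have h : (Real.exp 1)⁻¹ ≤ 2⁻¹ := inv_anti₀ (by norm_num) (by linarith [Real.exp_one_gt_d9])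
  rw [Real.exp_neg]
  linarith

lemma c₀_pos : 0 < c₀ := by
  unfold c₀
  refine mul_pos (by norm_num) (lt_min ?_ (mul_pos one_sub_exp_neg_one_pos ?_))
  · apply intervalIntegral.intervalIntegral_pos_of_pos_on
      (Continuous.intervalIntegrable (by fun_prop) _ _) _ (by norm_num)
    intro u hu
    have h1 : Real.exp (u - 1 / 2) < 1 := by
      rw [Real.exp_lt_one_iff]; linarith [hu.2]
    have := stdNormalDensity_pos u
    have := hu.1
    have : 0 < 1 - Real.exp (u - 1 / 2) := by linarith
    positivity
  · apply intervalIntegral.intervalIntegral_pos_of_pos_on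
      (Continuous.intervalIntegrable (by fun_prop) _ _) _ (by norm_num)
    intro u hu
    have := stdNormalDensity_pos u
    have := hu.1
    positivity

/-- Since `φ ≤ φ(0)` and `∫₀^{1/2} u³ du = 1/64`, one has `c₀ ≤ φ(0)/16`. For `a = 0` and distances
near `R`, the gain is a multiple of `p₀`, whereas the rate is bounded through `c₀`. -/
lemma c₀_le_p₀ : c₀ ≤ p₀ := by
  refine le_trans ?_ stdNormalDensity_zero_div_le_p₀
  have h1 : ∫ u in (0 : ℝ)..(1 / 2), u ^ 3 * stdNormalDensity u
      ≤ ∫ u in (0 : ℝ)..(1 / 2), u ^ 3 * stdNormalDensity 0 := by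
    apply intervalIntegral.integral_mono_on (by norm_num)
      (Continuous.intervalIntegrable (by fun_prop) _ _)
      (Continuous.intervalIntegrable (by fun_prop) _ _)
    intro u hu
    have h2 : stdNormalDensity u ≤ stdNormalDensity 0 := by
      unfold stdNormalDensity
      gcongr
      exact hu.1
    have := hu.1
    gcongr
  rw [intervalIntegral.integral_mul_const, integral_pow] at h1
  have h0 := stdNormalDensity_pos 0
  have h2 : (1 - Real.exp (-1)) * ∫ u in (0 : ℝ)..(1 / 2), u ^ 3 * stdNormalDensity u
      ≤ 1 * (stdNormalDensity 0 / 64) := by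
    refine mul_le_mul (by linarith [Real.exp_pos (-1)]) ?_ ?_ (by norm_num)
    · norm_num at h1; linarith
    · apply intervalIntegral.integral_nonneg (by norm_num)
      intro u hu
      have := stdNormalDensity_pos u
      have := hu.1
      positivity
  unfold c₀
  linarith [min_le_right (∫ u in (0 : ℝ)..(1 / 2),
    u ^ 2 * (1 - Real.exp (u - 1 / 2)) * stdNormalDensity u)
    ((1 - Real.exp (-1)) * ∫ u in (0 : ℝ)..(1 / 2), u ^ 3 * stdNormalDensity u)]

/-! ### The rejection probability and its moments -/

/-- The conditional probability, given the value `z` of the noise in the direction of reflection,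
that the two copies do not coalesce, when they are at distance `τ` in units of the noise. -/
def rejProb (τ z : ℝ) : ℝ := max 0 (1 - Real.exp (-(τ ^ 2 / 2 + τ * z)))

lemma rejProb_nonneg (τ z : ℝ) : 0 ≤ rejProb τ z := le_max_left _ _

lemma rejProb_le_one (τ z : ℝ) : rejProb τ z ≤ 1 :=
  max_le zero_le_one (by linarith [Real.exp_pos (-(τ ^ 2 / 2 + τ * z))])

@[fun_prop]
lemma continuous_rejProb (τ : ℝ) : Continuous (rejProb τ) := by
  unfold rejProb; fun_prop

/-- Rejection occurs only when the signed distance after reflection is positive; this is what allows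
its absolute value to be dropped. -/
lemma rejProb_eq_zero {τ z : ℝ} (hτ : 0 ≤ τ) (hz : τ + 2 * z ≤ 0) : rejProb τ z = 0 := by
  apply max_eq_left
  have : 0 ≤ -(τ ^ 2 / 2 + τ * z) := by nlinarith
  linarith [Real.one_le_exp this]

lemma rejProb_of_nonneg {τ z : ℝ} (hτ : 0 ≤ τ) (hz : 0 ≤ τ + 2 * z) :
    rejProb τ z = 1 - Real.exp (-(τ ^ 2 / 2 + τ * z)) := by
  apply max_eq_right
  have : -(τ ^ 2 / 2 + τ * z) ≤ 0 := by nlinarith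
  linarith [Real.exp_le_one_iff.2 this]

lemma integrable_rejProb_mul (τ : ℝ) {k : ℝ → ℝ} (hk : Integrable k (gaussianReal 0 1)) :
    Integrable (fun z => rejProb τ z * k z) (gaussianReal 0 1) := by
  refine hk.bdd_mul (c := 1) (continuous_rejProb τ).aestronglyMeasurable
    (Filter.Eventually.of_forall fun z => ?_)
  rw [Real.norm_of_nonneg (rejProb_nonneg _ _)]
  exact rejProb_le_one _ _

lemma integrable_id_gaussianReal : Integrable (fun z : ℝ => z) (gaussianReal 0 1) :=
  (memLp_id_gaussianReal 1).integrable le_rfl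

/-- The coupling preserves the expected distance. -/
lemma integral_rejProb_mul_dist {τ : ℝ} (hτ : 0 ≤ τ) :
    ∫ z, rejProb τ z * (τ + 2 * z) ∂(gaussianReal 0 1) = τ := by
  have hlin : Integrable (fun z : ℝ => τ + 2 * z) (gaussianReal 0 1) :=
    (integrable_const τ).add (integrable_id_gaussianReal.const_mul 2)
  have hlin' := (integrable_gaussianReal_iff _).1 hlin
  let p : ℝ → ℝ := (Set.Ioi (-τ / 2)).indicator fun z => stdNormalDensity z * (τ + 2 * z)
  let m : ℝ → ℝ := (Set.Iio (-τ / 2)).indicator fun z => stdNormalDensity z * (τ + 2 * z)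
  have hp : Integrable p := hlin'.indicator measurableSet_Ioi
  have hm : Integrable m := hlin'.indicator measurableSet_Iio
  have hpm : ∀ z, p z + m z = stdNormalDensity z * (τ + 2 * z) := by
    intro z
    rcases lt_trichotomy z (-τ / 2) with h | h | h
    · simp [p, m, h, h.le]
    · simp [p, m, h]; right; ring
    · simp [p, m, h, h.le]
  -- The map `z ↦ -τ - z` changes the sign of `τ + 2z` and multiplies the density by the acceptance
  -- ratio. The part subtracted on `z > -τ/2` thus becomes the integral over `z < -τ/2`.
  have hmain : ∀ z, stdNormalDensity z * (rejProb τ z * (τ + 2 * z)) = p z + m (-τ - z) := by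
    intro z
    rcases le_or_gt z (-τ / 2) with h | h
    · have h1 : ¬ (-τ - z < -τ / 2) := by linarith
      rw [rejProb_eq_zero hτ (by linarith)]
      simp only [p, m, Set.indicator, Set.mem_Ioi, Set.mem_Iio, h.not_gt, h1]
      simp
    · have h1 : -τ - z < -τ / 2 := by linarith
      rw [rejProb_of_nonneg hτ (by linarith)]
      simp only [p, m, Set.indicator, Set.mem_Ioi, Set.mem_Iio, h, h1, if_true]
      have h2 : stdNormalDensity (-τ - z)
          = stdNormalDensity z * Real.exp (-(τ ^ 2 / 2 + τ * z)) := by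
        unfold stdNormalDensity
        rw [mul_assoc, ← Real.exp_add]
        congr 2; ring
      rw [h2]; ring
  have hone : ∫ z, (τ + 2 * z) ∂(gaussianReal 0 1) = τ := by
    rw [integral_add (integrable_const τ) (integrable_id_gaussianReal.const_mul 2),
      integral_const_mul, integral_id_gaussianReal]
    simp
  rw [integral_gaussianReal_eq] at hone ⊢
  simp_rw [hmain]
  rw [integral_add hp (hm.comp_sub_left (-τ)), integral_sub_left_eq_self m volume (-τ),
    ← integral_add hp hm]
  simp_rw [hpm]
  exact hone

/-- For `τ ≥ 1` and `z = -u` with `0 ≤ u ≤ 1/2`, the exponent satisfies `τ²/2 - τu ≥ 1/2 - u`, which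
produces the first integral in `c₀`. -/
lemma c₀_le_integral_rejProb_mul_sq {τ : ℝ} (hτ : 1 ≤ τ) :
    c₀ ≤ ∫ z, (Set.Ioc (-(1 / 2)) 0).indicator (fun z => rejProb τ z * (4 * z ^ 2)) z
      ∂(gaussianReal 0 1) := by
  rw [integral_indicator_Ioc_gaussianReal (by norm_num)]
  have h1 := intervalIntegral.integral_comp_neg (a := 0) (b := 1 / 2)
    (fun z => rejProb τ z * (4 * z ^ 2) * stdNormalDensity z)
  rw [neg_zero] at h1
  rw [← h1]
  refine le_trans (mul_le_mul_of_nonneg_left (min_le_left _ _) (by norm_num)) ?_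
  rw [← intervalIntegral.integral_const_mul]
  apply intervalIntegral.integral_mono_on (by norm_num)
    (Continuous.intervalIntegrable (by fun_prop) _ _)
    (Continuous.intervalIntegrable (by fun_prop) _ _)
  intro u hu
  have h2 : 1 - Real.exp (u - 1 / 2) ≤ rejProb τ (-u) := by
    refine le_trans ?_ (le_max_right _ _)
    have : -(τ ^ 2 / 2 + τ * -u) ≤ u - 1 / 2 := by nlinarith [hu.1, hu.2]
    linarith [Real.exp_le_exp.2 this]
  have h3 := stdNormalDensity_pos u
  rw [stdNormalDensity_neg]
  have h4 : 0 ≤ (rejProb τ (-u) - (1 - Real.exp (u - 1 / 2))) * (4 * u ^ 2 * stdNormalDensity u) :=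
    mul_nonneg (by linarith) (by positivity)
  nlinarith

/-- The convex function `exp` lies below its chord over `[-1, 0]`. -/
lemma mul_le_one_sub_exp_neg {x : ℝ} (h0 : 0 ≤ x) (h1 : x ≤ 1) :
    (1 - Real.exp (-1)) * x ≤ 1 - Real.exp (-x) := by
  have h := convexOn_exp.2 (Set.mem_univ 0) (Set.mem_univ (-1)) (sub_nonneg.2 h1) h0 (by ring)
  simp at h
  linarith

lemma rejProb_ge {τ z : ℝ} (hτ : 0 ≤ τ) (hz : 0 ≤ z) (h : τ * z ≤ 1) :
    (1 - Real.exp (-1)) * (τ * z) ≤ rejProb τ z := by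
  refine (mul_le_one_sub_exp_neg (by positivity) h).trans (le_trans ?_ (le_max_right _ _))
  have : -(τ ^ 2 / 2 + τ * z) ≤ -(τ * z) := by nlinarith [sq_nonneg τ]
  linarith [Real.exp_le_exp.2 this]

lemma c₀_mul_le_integral_rejProb_mul_sq {τ : ℝ} (h0 : 0 ≤ τ) (hτ : τ ≤ 1) :
    c₀ * τ ≤ ∫ z, (Set.Ioc 0 (1 / 2)).indicator (fun z => rejProb τ z * (4 * z ^ 2)) z
      ∂(gaussianReal 0 1) := by
  rw [integral_indicator_Ioc_gaussianReal (by norm_num)]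
  refine le_trans (mul_le_mul_of_nonneg_right
    (mul_le_mul_of_nonneg_left (min_le_right _ _) (by norm_num)) h0) ?_
  rw [show ∀ I : ℝ, 4 * ((1 - Real.exp (-1)) * I) * τ = (4 * (1 - Real.exp (-1)) * τ) * I by
    intro I; ring, ← intervalIntegral.integral_const_mul]
  apply intervalIntegral.integral_mono_on (by norm_num)
    (Continuous.intervalIntegrable (by fun_prop) _ _)
    (Continuous.intervalIntegrable (by fun_prop) _ _)
  intro u hu
  have h2 := rejProb_ge h0 hu.1 (by nlinarith [hu.1, hu.2])
  have h3 := stdNormalDensity_pos u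
  have h4 := mul_le_mul_of_nonneg_right h2
    (show 0 ≤ 4 * u ^ 2 * stdNormalDensity u by positivity)
  nlinarith

/-- If `τ ≤ 1`, merging is certain on `z < -1`, an event of probability `p₀`. -/
lemma p₀_le_integral_one_sub_rejProb {τ : ℝ} (h0 : 0 ≤ τ) (hτ : τ ≤ 1) :
    p₀ ≤ ∫ z, (1 - rejProb τ z) ∂(gaussianReal 0 1) := by
  rw [← gaussianReal_real_Iio_neg_one, ← integral_indicator_one measurableSet_Iio]
  apply integral_mono ((integrable_const _).indicator measurableSet_Iio)
  · refine (integrable_const _).sub ?_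
    simpa using integrable_rejProb_mul τ (integrable_const (1 : ℝ))
  intro z
  by_cases hz : z < -1
  · have := rejProb_eq_zero (z := z) h0 (by linarith)
    simp [hz, this]
  · simp [hz, rejProb_le_one]

/-- On `z > 1` the rejection probability is at least `1 - e^{-τ} ≥ (1 - e⁻¹) τ ≥ τ/2`. -/
lemma p₀_mul_le_integral_rejProb {τ : ℝ} (h0 : 0 ≤ τ) (hτ : τ ≤ 1) :
    p₀ * (τ / 2) ≤ ∫ z, (Set.Ioi 1).indicator (fun z => rejProb τ z) z ∂(gaussianReal 0 1) := by
  rw [← gaussianReal_real_Ioi_one, ← smul_eq_mul,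
    ← integral_indicator_const _ measurableSet_Ioi]
  apply integral_mono ((integrable_const _).indicator measurableSet_Ioi)
  · refine Integrable.indicator ?_ measurableSet_Ioi
    simpa using integrable_rejProb_mul τ (integrable_const (1 : ℝ))
  intro z
  by_cases hz : 1 < z
  · simp only [Set.indicator, Set.mem_Ioi, hz, if_true]
    refine le_trans ?_ (le_max_right _ _)
    have h1 := mul_le_one_sub_exp_neg h0 hτ
    have h2 : -(τ ^ 2 / 2 + τ * z) ≤ -τ := by nlinarith [sq_nonneg τ]
    have h3 := Real.exp_le_exp.2 h2
    nlinarith [half_le_one_sub_exp_neg_one]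
  · simp [hz]

/-! ### The supremum defining the metric -/

lemma alphaLower_of_le {h v : ℝ} (hh : 0 < h) (hv : √h ≤ v) : alphaLower h v = c₀ * h := by
  rw [alphaLower, min_eq_right hv, mul_assoc, Real.mul_self_sqrt hh.le]

lemma mem_dualInterval {a h s v : ℝ} (hs : 0 < s) (h1 : s < v) (h2 : √h < v)
    (h3 : v < s + √h) : v ∈ dualInterval a h s := by
  have h4 : v - √h < s := by linarith
  have h5 : 0 ≤ √h := Real.sqrt_nonneg h
  by_cases ha : a = 0
  · simp [dualInterval, interval, ha, h2.not_gt, h1, h4, hs.trans h1]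
  · simp [dualInterval, interval, ha, h1, h4, h2, hs]

/-- For `v ≥ √h` the denominator is the constant `c₀h` and `v ≤ s + √h`. Values `v < √h` occur only
for `a = 0`, where the ratio is constantly `√h/(c₀h)`. -/
lemma ratio_le_of_mem_dualInterval {a h s v : ℝ} (ha : 0 ≤ a) (hh : 0 < h) (hs : 0 < s)
    (hv : v ∈ dualInterval a h s) :
    (a + v) / alphaLower h v ≤ (a + s + √h) / (c₀ * h) := by
  have hc := c₀_pos
  have hq : 0 < √h := Real.sqrt_pos.2 hh
  obtain ⟨h1, h2⟩ := hv
  rcases le_or_gt (√h) v with hv | hv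
  · rw [alphaLower_of_le hh hv]
    have : v ≤ s + √h := by
      by_cases ha : a = 0
      · simp only [interval, ha, hv.not_gt, if_true, if_false, Set.mem_Ioo] at h2
        linarith [h2.1]
      · simp only [interval, ha, if_false, Set.mem_Ioo, max_lt_iff] at h2
        linarith [h2.1.1]
    gcongr ?_ / _
    linarith
  · have ha0 : a = 0 := by
      by_contra ha
      rw [if_neg ha] at h1
      linarith
    rw [if_pos ha0] at h1
    have h3 : (a + v) / alphaLower h v = √h / (c₀ * h) := by
      rw [ha0, alphaLower, min_eq_left hv.le]
      field_simp
      rw [Real.sq_sqrt hh.le]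
      ring
    rw [h3]
    gcongr
    linarith

/-- The bound is approached as `v ↑ s + √h`, but not attained. Positivity of `s` matters: for `s =
0` the dual interval is empty. -/
lemma supRatio_eq {a h s : ℝ} (ha : 0 ≤ a) (hh : 0 < h) (hs : 0 < s) :
    supRatio a h s = (a + s + √h) / (c₀ * h) := by
  have hc := c₀_pos
  have hq : 0 < √h := Real.sqrt_pos.2 hh
  refine IsLUB.csSup_eq ⟨?_, ?_⟩ ?_
  · rintro _ ⟨v, hv, rfl⟩
    exact ratio_le_of_mem_dualInterval ha hh hs hv
  · intro β hβ
    rw [div_le_iff₀ (by positivity)]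
    by_contra! hlt
    obtain ⟨v, hv1, hv2⟩ := exists_between
      (show max (max s (√h)) (β * (c₀ * h) - a) < s + √h from
        max_lt (max_lt (by linarith) (by linarith)) (by linarith))
    simp only [max_lt_iff] at hv1
    have h1 := hβ ⟨v, mem_dualInterval hs hv1.1.1 hv1.1.2 hv2, rfl⟩
    simp only at h1
    rw [alphaLower_of_le hh hv1.1.2.le, div_le_iff₀ (by positivity)] at h1
    linarith [hv1.2]
  · obtain ⟨v, hv1, hv2⟩ := exists_between
      (show max s (√h) < s + √h from max_lt (by linarith) (by linarith))
    simp only [max_lt_iff] at hv1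
    exact ⟨_, v, mem_dualInterval hs hv1.1 hv1.2 hv2, rfl⟩

lemma integral_supRatio {a h u : ℝ} (ha : 0 ≤ a) (hh : 0 < h) (hu : 0 ≤ u) :
    ∫ s in (0 : ℝ)..u, supRatio a h s = ((a + √h) * u + u ^ 2 / 2) / (c₀ * h) := by
  have h1 : ∫ s in (0 : ℝ)..u, supRatio a h s
      = ∫ s in (0 : ℝ)..u, ((a + √h) + s) / (c₀ * h) := by
    rw [intervalIntegral.integral_of_le hu, intervalIntegral.integral_of_le hu]
    refine setIntegral_congr_fun measurableSet_Ioc fun s hs => ?_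
    simp only [supRatio_eq ha hh hs.1]
    ring
  rw [h1, intervalIntegral.integral_div, intervalIntegral.integral_add (by simp) (by simp)]
  simp
  ring

/-! ### The metric in closed form -/

/-- The slope at `u` of the distance function, with curvature parameters `M` and `A`. -/
def slope (M A u : ℝ) : ℝ := 1 - M * (A * u + u ^ 2 / 2)

/-- The concave distance function in closed form: a cubic up to `R`, and affine beyond. -/
def profile (M A R r : ℝ) : ℝ :=
  min r R - M * (A * min r R ^ 2 / 2 + min r R ^ 3 / 6) + slope M A (min r R) * (r - min r R)

/-- The factor `2 c / (c₀ h)` in the second derivative of the distance function. -/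
def curvature (R h a : ℝ) : ℝ := 2 * metricConst R h a / (c₀ * h)

lemma g_eq_slope {R h a u : ℝ} (ha : 0 ≤ a) (hh : 0 < h) (hu : 0 ≤ u) :
    g R h a u = slope (curvature R h a) (a + √h) u := by
  rw [g, integral_supRatio ha hh hu, slope, curvature]
  ring

lemma integral_slope (M A r s : ℝ) :
    ∫ u in r..s, slope M A u = (s - M * (A * s ^ 2 / 2 + s ^ 3 / 6))
      - (r - M * (A * r ^ 2 / 2 + r ^ 3 / 6)) := by
  apply intervalIntegral.integral_eq_sub_of_hasDerivAt
    (f := fun u => u - M * (A * u ^ 2 / 2 + u ^ 3 / 6))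
  · intro u _
    have h1 := (hasDerivAt_id u).sub ((((((hasDerivAt_id u).pow 2).const_mul A).div_const 2).add
      (((hasDerivAt_id u).pow 3).div_const 6)).const_mul M)
    refine h1.congr_deriv ?_
    simp only [slope, id, Nat.cast_ofNat, Nat.add_one_sub_one, pow_one, mul_one]
    ring
  · apply Continuous.intervalIntegrable
    unfold slope; fun_prop

lemma f_eq_profile {R h a r : ℝ} (ha : 0 ≤ a) (hh : 0 < h) (hR : 0 < R) (hr : 0 ≤ r) :
    f R h a r = profile (curvature R h a) (a + √h) R r := by
  have hcont : Continuous fun s => slope (curvature R h a) (a + √h) (min s R) := by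
    unfold slope; fun_prop
  have h1 : f R h a r = ∫ s in (0 : ℝ)..r, slope (curvature R h a) (a + √h) (min s R) := by
    apply intervalIntegral.integral_congr
    intro s hs
    rw [Set.uIcc_of_le hr] at hs
    exact g_eq_slope ha hh (le_min hs.1 hR.le)
  have hm : 0 ≤ min r R := le_min hr hR.le
  have h2 : ∫ s in (0 : ℝ)..min r R, slope (curvature R h a) (a + √h) (min s R)
      = ∫ s in (0 : ℝ)..min r R, slope (curvature R h a) (a + √h) s := by
    apply intervalIntegral.integral_congr
    intro s hs
    rw [Set.uIcc_of_le hm] at hs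
    simp only [min_eq_left (hs.2.trans (min_le_right _ _))]
  have h3 : ∫ s in min r R..r, slope (curvature R h a) (a + √h) (min s R)
      = ∫ _ in min r R..r, slope (curvature R h a) (a + √h) (min r R) := by
    apply intervalIntegral.integral_congr
    intro s hs
    rw [Set.uIcc_of_le (min_le_left _ _)] at hs
    have hsr : min s R = min r R :=
      le_antisymm (min_le_min_right R hs.2) (le_min hs.1 (min_le_right _ _))
    simp only [hsr]
  rw [h1, ← intervalIntegral.integral_add_adjacent_intervals
    (hcont.intervalIntegrable 0 (min r R)) (hcont.intervalIntegrable (min r R) r), h2, h3,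
    integral_slope, profile, intervalIntegral.integral_const]
  simp
  ring

lemma metricConst_pos {R h a : ℝ} (ha : 0 ≤ a) (hh : 0 < h) (hR : 0 < R) :
    0 < metricConst R h a := by
  have hc := c₀_pos
  have hp := p₀_pos
  have hq : 0 < √h := Real.sqrt_pos.2 hh
  rw [metricConst, integral_supRatio ha hh hR.le]
  split_ifs <;> positivity

lemma metricConst_le {R h a : ℝ} (ha : 0 ≤ a) (hh : 0 < h) (hR : 0 < R) :
    metricConst R h a ≤ 1 / 4 * (((a + √h) * R + R ^ 2 / 2) / (c₀ * h))⁻¹ := by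
  rw [metricConst, integral_supRatio ha hh hR.le]
  split_ifs
  · exact le_rfl
  · exact min_le_right _ _

lemma curvature_pos {R h a : ℝ} (ha : 0 ≤ a) (hh : 0 < h) (hR : 0 < R) :
    0 < curvature R h a := by
  have hc := c₀_pos
  have := metricConst_pos ha hh hR
  unfold curvature; positivity

/-- The factor `1/4` in `c` is chosen so that the slope loses at most `1/2` over `[0, R]`. For `a =
0`, where `c` is not capped by `p₀/2`, the loss is exactly `1/2`. -/
lemma curvature_mul_le {R h a : ℝ} (ha : 0 ≤ a) (hh : 0 < h) (hR : 0 < R) :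
    curvature R h a * ((a + √h) * R + R ^ 2 / 2) ≤ 1 / 2 := by
  have hc := c₀_pos
  have hq : 0 < √h := Real.sqrt_pos.2 hh
  have h1 := mul_le_mul_of_nonneg_left (metricConst_le ha hh hR)
    (show 0 ≤ 2 * (((a + √h) * R + R ^ 2 / 2) / (c₀ * h)) by positivity)
  have h2 : curvature R h a * ((a + √h) * R + R ^ 2 / 2)
      = 2 * (((a + √h) * R + R ^ 2 / 2) / (c₀ * h)) * metricConst R h a := by
    rw [curvature]; ring
  rw [h2]
  refine h1.trans (le_of_eq ?_)
  have : (a + √h) * R + R ^ 2 / 2 ≠ 0 := by positivity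
  field_simp
  norm_num

lemma curvature_zero {R h : ℝ} (hh : 0 < h) (hR : 0 < R) :
    curvature R h 0 * (√h * R + R ^ 2 / 2) = 1 / 2 := by
  have hc := c₀_pos
  have hq : 0 < √h := Real.sqrt_pos.2 hh
  rw [curvature, metricConst, if_pos rfl, integral_supRatio le_rfl hh hR.le]
  have : √h * R + R ^ 2 / 2 ≠ 0 := by positivity
  simp only [zero_add]
  field_simp
  norm_num

/-! ### Concavity of the profile and defects of its tangents -/

section Profile

variable {M A R : ℝ}

lemma slope_antitone (hM : 0 ≤ M) (hA : 0 ≤ A) {u v : ℝ} (hu : 0 ≤ u) (huv : u ≤ v) :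
    slope M A v ≤ slope M A u := by
  unfold slope
  gcongr

lemma slope_le_one (hM : 0 ≤ M) (hA : 0 ≤ A) {u : ℝ} (hu : 0 ≤ u) : slope M A u ≤ 1 := by
  have : 0 ≤ M * (A * u + u ^ 2 / 2) := by positivity
  unfold slope; linarith

lemma half_le_slope (hM : 0 ≤ M) (hA : 0 ≤ A) (hMR : M * (A * R + R ^ 2 / 2) ≤ 1 / 2) {u : ℝ}
    (hu : 0 ≤ u) (huR : u ≤ R) : 1 / 2 ≤ slope M A u := by
  refine le_trans ?_ (slope_antitone hM hA hu huR)
  unfold slope; linarith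

@[fun_prop]
lemma continuous_profile : Continuous (profile M A R) := by
  unfold profile slope; fun_prop

lemma profile_of_le {r : ℝ} (hr : r ≤ R) :
    profile M A R r = r - M * (A * r ^ 2 / 2 + r ^ 3 / 6) := by
  simp [profile, hr]

lemma profile_of_ge {r : ℝ} (hr : R ≤ r) :
    profile M A R r = profile M A R R + slope M A R * (r - R) := by
  simp [profile, hr]

lemma profile_zero (hR : 0 ≤ R) : profile M A R 0 = 0 := by
  simp [profile_of_le hR]

/-- Up to `R`, the defect of the tangent at `t` is controlled by the second derivative. -/
lemma profile_tangent_eq {s t : ℝ} (hs : s ≤ R) (ht : t ≤ R) :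
    profile M A R s = profile M A R t + slope M A t * (s - t)
      - M * (A + t + (s - t) / 3) * (s - t) ^ 2 / 2 := by
  rw [profile_of_le hs, profile_of_le ht, slope]
  ring

lemma profile_le_tangent (hM : 0 ≤ M) (hA : 0 ≤ A) (hR : 0 ≤ R) {s t : ℝ} (hs : 0 ≤ s)
    (ht : 0 ≤ t) :
    profile M A R s ≤ profile M A R t + slope M A (min t R) * (s - t) := by
  have key : ∀ s t, 0 ≤ s → s ≤ R → 0 ≤ t → t ≤ R →
      profile M A R s ≤ profile M A R t + slope M A t * (s - t) := by
    intro s t hs hsR ht htR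
    rw [profile_tangent_eq hsR htR]
    have : 0 ≤ M * (A + t + (s - t) / 3) * (s - t) ^ 2 / 2 := by
      have : 0 ≤ A + t + (s - t) / 3 := by linarith
      positivity
    linarith
  rcases le_total s R with hsR | hsR <;> rcases le_total t R with htR | htR
  · rw [min_eq_left htR]
    exact key s t hs hsR ht htR
  · rw [min_eq_right htR, profile_of_ge htR]
    linarith [key s R hs hsR hR le_rfl]
  · rw [min_eq_left htR, profile_of_ge hsR]
    have h1 := key R t hR le_rfl ht htR
    have h2 := mul_le_mul_of_nonneg_right (slope_antitone hM hA ht htR) (sub_nonneg.2 hsR)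
    linarith
  · rw [min_eq_right htR, profile_of_ge hsR, profile_of_ge htR]
    linarith

lemma profile_le (hM : 0 ≤ M) (hA : 0 ≤ A) (hR : 0 ≤ R) {s : ℝ} (hs : 0 ≤ s) :
    profile M A R s ≤ s := by
  have := profile_le_tangent hM hA hR hs le_rfl
  simpa [profile_zero hR, hR, slope] using this

lemma half_sub_le_profile_sub (hM : 0 ≤ M) (hA : 0 ≤ A) (hR : 0 ≤ R)
    (hMR : M * (A * R + R ^ 2 / 2) ≤ 1 / 2) {s t : ℝ} (hs : 0 ≤ s) (hst : s ≤ t) :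
    (t - s) / 2 ≤ profile M A R t - profile M A R s := by
  have h1 := profile_le_tangent hM hA hR hs (hs.trans hst)
  have h2 := half_le_slope hM hA hMR (le_min (hs.trans hst) hR) (min_le_right t R)
  nlinarith

lemma half_le_profile (hM : 0 ≤ M) (hA : 0 ≤ A) (hR : 0 ≤ R)
    (hMR : M * (A * R + R ^ 2 / 2) ≤ 1 / 2) {s : ℝ} (hs : 0 ≤ s) :
    s / 2 ≤ profile M A R s := by
  have := half_sub_le_profile_sub hM hA hR hMR le_rfl hs
  simpa [profile_zero hR] using this

/-- On `[t - δ, t]` the curvature `M (A + u)` is at least its value at `t - δ`. With `A = a + √h`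
and `δ = √h` this leaves `M (a + t)`. -/
lemma profile_le_tangent_sub_of_le (hM : 0 ≤ M) {s t δ : ℝ} (hδ : 0 ≤ δ) (hst : s ≤ t)
    (hts : t ≤ s + δ) (htR : t ≤ R) :
    profile M A R s ≤ profile M A R t + slope M A t * (s - t)
      - M * (A - δ + t) * (s - t) ^ 2 / 2 := by
  rw [profile_tangent_eq (hst.trans htR) htR]
  have : 0 ≤ M * (δ + (s - t) / 3) * (s - t) ^ 2 / 2 := by
    have : 0 ≤ δ + (s - t) / 3 := by linarith
    positivity
  linarith

lemma profile_le_tangent_sub_of_ge (hM : 0 ≤ M) {s t : ℝ} (hst : t ≤ s) (hsR : s ≤ R) :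
    profile M A R s ≤ profile M A R t + slope M A t * (s - t)
      - M * (A + t) * (s - t) ^ 2 / 2 := by
  rw [profile_tangent_eq hsR (hst.trans hsR)]
  have : 0 ≤ M * ((s - t) / 3) * (s - t) ^ 2 / 2 := by
    have : 0 ≤ (s - t) / 3 := by linarith
    positivity
  linarith

/-- This bounds below the intercept at `0` of the tangent at `t`, which is the gain when the copies
merge. -/
lemma zero_le_tangent_sub (hM : 0 ≤ M) {t : ℝ} (ht : 0 ≤ t) (htR : t ≤ R) :
    0 ≤ profile M A R t - slope M A t * t - M * A * t ^ 2 / 2 := by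
  have h := profile_tangent_eq (M := M) (A := A) (ht.trans htR) htR
  rw [profile_zero (ht.trans htR)] at h
  have : 0 ≤ M * (t ^ 3) / 3 := by positivity
  linarith

/-- The slope is at least `3/4` at `t ≤ R/2` but equals `1/2` beyond `R`, so past `R` the tangent
pulls away at rate at least `1/4`. -/
lemma profile_le_tangent_sub_of_far (hM : 0 ≤ M) (hA : 0 ≤ A)
    (hMR : M * (A * R + R ^ 2 / 2) = 1 / 2) {s t δ : ℝ} (hδ : 0 ≤ δ) (ht : 0 ≤ t)
    (htR : 2 * t ≤ R) (hs : R + δ ≤ s) :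
    profile M A R s ≤ profile M A R t + slope M A t * (s - t) - δ / 4 := by
  have hR : 0 ≤ R := by linarith
  have h1 := profile_le_tangent hM hA hR hR ht
  rw [min_eq_left (by linarith)] at h1
  rw [profile_of_ge (by linarith)]
  have h2 : slope M A R = 1 / 2 := by rw [slope, hMR]; norm_num
  have h3 : 3 / 4 ≤ slope M A t := by
    have : M * (A * t + t ^ 2 / 2) ≤ M * ((A * R + R ^ 2 / 2) / 2) := by
      apply mul_le_mul_of_nonneg_left _ hM
      nlinarith
    unfold slope; linarith
  rw [h2]
  nlinarith

end Profile

/-! ### Expected profile after one step, by range of `t` -/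

section OneDim

variable {M A R σ t : ℝ}

lemma integrable_dist (σ t : ℝ) : Integrable (fun z : ℝ => t + 2 * σ * z) (gaussianReal 0 1) :=
  (integrable_const t).add (integrable_id_gaussianReal.const_mul (2 * σ))

lemma integrable_rejProb (τ : ℝ) : Integrable (rejProb τ) (gaussianReal 0 1) := by
  simpa using integrable_rejProb_mul τ (integrable_const (1 : ℝ))

lemma rejProb_eq_zero_of_dist_neg (hσ : 0 < σ) (ht : 0 ≤ t) {z : ℝ} (hz : t + 2 * σ * z ≤ 0) :
    rejProb (t / σ) z = 0 := by
  apply rejProb_eq_zero (by positivity)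
  have : t / σ + 2 * z = (t + 2 * σ * z) / σ := by field_simp
  rw [this]
  exact div_nonpos_of_nonpos_of_nonneg hz hσ.le

lemma integral_rejProb_mul_dist' (hσ : 0 < σ) (ht : 0 ≤ t) :
    ∫ z, rejProb (t / σ) z * (t + 2 * σ * z) ∂(gaussianReal 0 1) = t := by
  have h1 : ∀ z, rejProb (t / σ) z * (t + 2 * σ * z)
      = σ * (rejProb (t / σ) z * (t / σ + 2 * z)) := by
    intro z; field_simp
  simp_rw [h1]
  rw [integral_const_mul, integral_rejProb_mul_dist (by positivity)]
  field_simp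

lemma integrable_abs_profile (hM : 0 ≤ M) (hA : 0 ≤ A) (hR : 0 ≤ R)
    (hMR : M * (A * R + R ^ 2 / 2) ≤ 1 / 2) (σ t : ℝ) :
    Integrable (fun z => profile M A R |t + 2 * σ * z|) (gaussianReal 0 1) := by
  refine (integrable_dist σ t).mono (Continuous.aestronglyMeasurable (by fun_prop))
    (Filter.Eventually.of_forall fun z => ?_)
  have h1 := half_le_profile hM hA hR hMR (abs_nonneg (t + 2 * σ * z))
  have h2 := abs_nonneg (t + 2 * σ * z)
  rw [Real.norm_of_nonneg (by linarith), Real.norm_eq_abs]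
  exact profile_le hM hA hR h2

/-- The expected value of the distance function after one step is bounded by its value at `t`, up
to the mass at zero and a lower bound `w` of the defect of the tangent at `t`. -/
lemma integral_rejProb_mul_profile_le (hM : 0 ≤ M) (hA : 0 ≤ A) (hR : 0 ≤ R)
    (hMR : M * (A * R + R ^ 2 / 2) ≤ 1 / 2) (hσ : 0 < σ) (ht : 0 ≤ t) {w : ℝ → ℝ}
    (hw : Integrable (fun z => rejProb (t / σ) z * w z) (gaussianReal 0 1))
    (hle : ∀ z, 0 ≤ t + 2 * σ * z → profile M A R (t + 2 * σ * z)
      ≤ profile M A R t + slope M A (min t R) * (t + 2 * σ * z - t) - w z) :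
    ∫ z, rejProb (t / σ) z * profile M A R |t + 2 * σ * z| ∂(gaussianReal 0 1)
      ≤ profile M A R t - ∫ z, rejProb (t / σ) z * w z ∂(gaussianReal 0 1)
        - (profile M A R t - slope M A (min t R) * t)
          * ∫ z, (1 - rejProb (t / σ) z) ∂(gaussianReal 0 1) := by
  set m := slope M A (min t R)
  -- `B` is the intercept of the tangent at `t`. Writing `rejProb * B` as `B - B * (1 - rejProb)`
  -- isolates the contribution of merging.
  set B := profile M A R t - m * t
  have hψ : Integrable (fun z => B * (1 - rejProb (t / σ) z)) (gaussianReal 0 1) :=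
    ((integrable_const _).sub (integrable_rejProb (t / σ))).const_mul B
  have hB : Integrable (fun z => B - B * (1 - rejProb (t / σ) z)) (gaussianReal 0 1) :=
    (integrable_const _).sub hψ
  have hd := integrable_rejProb_mul (t / σ) (integrable_dist σ t)
  have hBd : Integrable (fun z => B - B * (1 - rejProb (t / σ) z)
      + m * (rejProb (t / σ) z * (t + 2 * σ * z))) (gaussianReal 0 1) := hB.add (hd.const_mul m)
  have h1 : ∫ z, rejProb (t / σ) z * profile M A R |t + 2 * σ * z| ∂(gaussianReal 0 1)
      ≤ ∫ z, (B - B * (1 - rejProb (t / σ) z) + m * (rejProb (t / σ) z * (t + 2 * σ * z))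
        - rejProb (t / σ) z * w z) ∂(gaussianReal 0 1) := by
    apply integral_mono (integrable_rejProb_mul _ (integrable_abs_profile hM hA hR hMR σ t))
    · exact hBd.sub hw
    intro z
    simp only
    rcases le_or_gt 0 (t + 2 * σ * z) with hz | hz
    · rw [abs_of_nonneg hz]
      have := mul_le_mul_of_nonneg_left (hle z hz) (rejProb_nonneg (t / σ) z)
      simp only [B]
      linarith
    · simp [rejProb_eq_zero_of_dist_neg hσ ht hz.le]
  refine h1.trans (le_of_eq ?_)
  rw [integral_sub hBd hw, integral_add hB (hd.const_mul m),
    integral_sub (integrable_const _) hψ,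
    integral_const_mul, integral_const_mul, integral_rejProb_mul_dist' hσ ht]
  simp only [integral_const, probReal_univ, one_smul, B]
  ring

lemma integral_one_sub_rejProb_nonneg (τ : ℝ) :
    0 ≤ ∫ z, (1 - rejProb τ z) ∂(gaussianReal 0 1) :=
  integral_nonneg fun z => sub_nonneg.2 (rejProb_le_one τ z)

lemma integral_one_sub_rejProb (τ : ℝ) :
    ∫ z, (1 - rejProb τ z) ∂(gaussianReal 0 1) = 1 - ∫ z, rejProb τ z ∂(gaussianReal 0 1) := by
  rw [integral_sub (integrable_const _) (integrable_rejProb τ)]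
  simp

lemma tangent_at_zero_nonneg (hM : 0 ≤ M) (hA : 0 ≤ A) (hR : 0 ≤ R) (ht : 0 ≤ t) :
    0 ≤ profile M A R t - slope M A (min t R) * t := by
  have := profile_le_tangent hM hA hR le_rfl ht
  rw [profile_zero hR] at this
  linarith

/-- The defect is counted on `S` only, plain concavity is used elsewhere, and the merging term is
dropped, being nonnegative. -/
lemma integral_rejProb_mul_profile_le_sub (hM : 0 ≤ M) (hA : 0 ≤ A) (hR : 0 ≤ R)
    (hMR : M * (A * R + R ^ 2 / 2) ≤ 1 / 2) (hσ : 0 < σ) (ht : 0 ≤ t) {S : Set ℝ}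
    (hS : MeasurableSet S) {k : ℝ → ℝ} (hk : Integrable k (gaussianReal 0 1)) {κ G : ℝ}
    (hle : ∀ z ∈ S, 0 ≤ t + 2 * σ * z → profile M A R (t + 2 * σ * z)
      ≤ profile M A R t + slope M A (min t R) * (t + 2 * σ * z - t) - κ * k z)
    (hκ : 0 ≤ κ)
    (hG : G ≤ ∫ z, S.indicator (fun z => rejProb (t / σ) z * k z) z ∂(gaussianReal 0 1)) :
    ∫ z, rejProb (t / σ) z * profile M A R |t + 2 * σ * z| ∂(gaussianReal 0 1)
      ≤ profile M A R t - κ * G := by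
  have hw : (fun z => rejProb (t / σ) z * S.indicator (fun z => κ * k z) z)
      = fun z => κ * S.indicator (fun z => rejProb (t / σ) z * k z) z := by
    ext z
    by_cases hz : z ∈ S
    · simp only [Set.indicator_of_mem hz]; ring
    · simp [hz]
  have h1 := integral_rejProb_mul_profile_le hM hA hR hMR hσ ht
    (w := S.indicator fun z => κ * k z) ?_ ?_
  · rw [hw, integral_const_mul] at h1
    have h2 := mul_nonneg (tangent_at_zero_nonneg hM hA hR ht)
      (integral_one_sub_rejProb_nonneg (t / σ))
    have h3 := mul_le_mul_of_nonneg_left hG hκ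
    linarith
  · rw [hw]
    exact ((integrable_rejProb_mul _ hk).indicator hS).const_mul κ
  · intro z hz
    by_cases hzS : z ∈ S
    · simp only [Set.indicator_of_mem hzS]
      exact hle z hzS hz
    · simp only [Set.indicator_of_notMem hzS, sub_zero]
      exact profile_le_tangent hM hA hR hz ht

lemma integrable_four_mul_sq : Integrable (fun z : ℝ => 4 * z ^ 2) (gaussianReal 0 1) :=
  ((memLp_id_gaussianReal 2).integrable_sq).const_mul 4

lemma integral_rejProb_mul_profile_le_self (hM : 0 ≤ M) (hA : 0 ≤ A) (hR : 0 ≤ R)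
    (hMR : M * (A * R + R ^ 2 / 2) ≤ 1 / 2) (hσ : 0 < σ) (ht : 0 ≤ t) :
    ∫ z, rejProb (t / σ) z * profile M A R |t + 2 * σ * z| ∂(gaussianReal 0 1)
      ≤ profile M A R t := by
  have := integral_rejProb_mul_profile_le_sub hM hA hR hMR hσ ht (S := ∅) (k := 0) (κ := 0)
    (G := 0) MeasurableSet.empty (integrable_zero _ _ _) (by simp) le_rfl (by simp)
  simpa using this

/-- Noise `z ∈ (-1/2, 0]` moves the distance inward by at most `σ`, and the squared displacement is
`σ² · 4z²`. -/
lemma integral_rejProb_mul_profile_le_of_le (hM : 0 ≤ M) (hA : σ ≤ A) (hR : 0 ≤ R)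
    (hMR : M * (A * R + R ^ 2 / 2) ≤ 1 / 2) (hσ : 0 < σ) (ht : σ ≤ t) (htR : t ≤ R) :
    ∫ z, rejProb (t / σ) z * profile M A R |t + 2 * σ * z| ∂(gaussianReal 0 1)
      ≤ profile M A R t - M * (A - σ + t) * σ ^ 2 / 2 * c₀ := by
  have ht0 : 0 ≤ t := hσ.le.trans ht
  apply integral_rejProb_mul_profile_le_sub hM (hσ.le.trans hA) hR hMR hσ ht0 measurableSet_Ioc
    integrable_four_mul_sq _ _ (c₀_le_integral_rejProb_mul_sq ((one_le_div hσ).2 ht))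
  · intro z hz _
    have := profile_le_tangent_sub_of_le (M := M) (A := A) (s := t + 2 * σ * z) hM hσ.le
      (by nlinarith [hz.2]) (by nlinarith [hz.1]) htR
    rw [min_eq_left htR]
    refine this.trans (le_of_eq ?_)
    ring
  · have : 0 ≤ A - σ + t := by linarith
    positivity

/-- For `t ≤ σ` outward moves, `z ∈ (0, 1/2]`, are used instead; they stay below `t + σ ≤ R`, where
the profile is strictly curved when `M > 0`. -/
lemma integral_rejProb_mul_profile_le_of_ge (hM : 0 ≤ M) (hA : 0 ≤ A) (hR : 0 ≤ R)
    (hMR : M * (A * R + R ^ 2 / 2) ≤ 1 / 2) (hσ : 0 < σ) (ht : 0 ≤ t) (htσ : t ≤ σ)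
    (htR : t + σ ≤ R) :
    ∫ z, rejProb (t / σ) z * profile M A R |t + 2 * σ * z| ∂(gaussianReal 0 1)
      ≤ profile M A R t - M * (A + t) * σ ^ 2 / 2 * (c₀ * (t / σ)) := by
  apply integral_rejProb_mul_profile_le_sub hM hA hR hMR hσ ht measurableSet_Ioc
    integrable_four_mul_sq _ _
    (c₀_mul_le_integral_rejProb_mul_sq (by positivity) ((div_le_one hσ).2 htσ))
  · intro z hz _
    have := profile_le_tangent_sub_of_ge (M := M) (A := A) (s := t + 2 * σ * z) (t := t) hM
      (by nlinarith [hz.1]) (show _ ≤ R by nlinarith [hz.2])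
    rw [min_eq_left (by linarith)]
    refine this.trans (le_of_eq ?_)
    ring
  · positivity

lemma integral_rejProb_mul_profile_le_of_mass (hM : 0 ≤ M) (hA : 0 ≤ A)
    (hMR : M * (A * R + R ^ 2 / 2) ≤ 1 / 2) (hσ : 0 < σ) (ht : 0 ≤ t) (htσ : t ≤ σ)
    (htR : t ≤ R) :
    ∫ z, rejProb (t / σ) z * profile M A R |t + 2 * σ * z| ∂(gaussianReal 0 1)
      ≤ profile M A R t - M * A * t ^ 2 / 2 * p₀ := by
  have h1 := integral_rejProb_mul_profile_le hM hA (ht.trans htR) hMR hσ ht (w := 0) (by simp)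
    (fun z hz => by simpa using profile_le_tangent hM hA (ht.trans htR) hz ht)
  have h2 := p₀_le_integral_one_sub_rejProb (τ := t / σ) (by positivity) ((div_le_one hσ).2 htσ)
  have h3 := zero_le_tangent_sub (A := A) hM ht htR
  have h4 : 0 ≤ M * A * t ^ 2 / 2 := by positivity
  rw [min_eq_left htR] at h1
  have h5 := mul_le_mul (show M * A * t ^ 2 / 2 ≤ profile M A R t - slope M A t * t by linarith)
    h2 p₀_pos.le (by linarith)
  simp only [Pi.zero_apply, mul_zero, integral_zero] at h1
  linarith

/-- Noise `z > 1` carries the distance past `t + 2σ ≥ R + σ`, where the defect is `σ/4`; unmerged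
jumps of this kind have probability at least `p₀ t/(2σ)`. -/
lemma integral_rejProb_mul_profile_le_of_far (hM : 0 ≤ M) (hA : 0 ≤ A)
    (hMR : M * (A * R + R ^ 2 / 2) = 1 / 2) (hσ : 0 < σ) (ht : 0 ≤ t) (htσ : t ≤ σ)
    (htR : 2 * t ≤ R) (hR : R ≤ t + σ) :
    ∫ z, rejProb (t / σ) z * profile M A R |t + 2 * σ * z| ∂(gaussianReal 0 1)
      ≤ profile M A R t - p₀ * t / 8 := by
  have h1 := integral_rejProb_mul_profile_le_sub (S := Set.Ioi 1) (κ := σ / 4) (k := fun _ => 1)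
    hM hA (by linarith) hMR.le hσ ht measurableSet_Ioi (integrable_const _) ?_ (by positivity)
    (by simpa using p₀_mul_le_integral_rejProb (by positivity) ((div_le_one hσ).2 htσ))
  · refine h1.trans (le_of_eq ?_)
    field_simp
    ring
  · intro z hz _
    rw [min_eq_left (by linarith), mul_one]
    have : 1 < z := hz
    exact profile_le_tangent_sub_of_far hM hA hMR hσ.le ht htR (by nlinarith)

end OneDim

/-! ### Comparison with the rate `c₁(a)` -/

section Rate

variable {K R h a t r : ℝ}

lemma metricConst_eq_zero (hh : 0 < h) (hR : 0 < R) :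
    metricConst R h 0 = 1 / 4 * (2 * c₀ / (R ^ 2 + 2 * √h * R)) * h := by
  have hc := c₀_pos
  rw [metricConst, if_pos rfl, integral_supRatio le_rfl hh hR.le]
  have : √h * R + R ^ 2 / 2 ≠ 0 := by positivity
  simp only [zero_add]
  field_simp
  ring

lemma metricConst_eq (ha : 0 < a) (hh : 0 < h) (hR : 0 < R) :
    metricConst R h a
      = 1 / 4 * min (2 * c₀ / (R ^ 2 + 2 * (a + √h) * R)) (2 * p₀ / h) * h := by
  have hc := c₀_pos
  rw [metricConst, if_neg ha.ne', integral_supRatio ha.le hh hR.le, mul_right_comm,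
    mul_min_of_nonneg _ _ (by positivity : 0 ≤ 1 / 4 * h), min_comm]
  have : (a + √h) * R + R ^ 2 / 2 ≠ 0 := by positivity
  congr 1
  · field_simp
    ring
  · field_simp
    norm_num

lemma c₁_mul_le_metricConst (ha : 0 ≤ a) (hh : 0 < h) (hR : 0 < R) :
    c₁ K R h a * h ≤ metricConst R h a := by
  have hc := c₀_pos
  rcases ha.eq_or_lt with rfl | ha
  · rw [metricConst_eq_zero hh hR, c₁, if_pos rfl]
    refine mul_le_mul_of_nonneg_right (mul_le_mul_of_nonneg_left
      ((min_le_right _ _).trans ?_) (by norm_num)) hh.le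
    exact div_le_div_of_nonneg_left (by positivity) (by positivity) (by linarith)
  · rw [metricConst_eq ha hh hR, c₁, if_neg ha.ne']
    exact mul_le_mul_of_nonneg_right (mul_le_mul_of_nonneg_left (min_le_right _ _)
      (by norm_num)) hh.le

/-- This is the role of the term `12h` in `c₁(0)`: it keeps the rate below what the boundary layer
near `R` can deliver. -/
lemma c₁_zero_mul_le (hh : 0 < h) (hR : 0 < R) : c₁ K R h 0 * h ≤ c₀ / 24 := by
  have hc := c₀_pos
  rw [c₁, if_pos rfl]
  have h1 : 2 * c₀ / (R ^ 2 + 2 * √h * R + 12 * h) ≤ 2 * c₀ / (12 * h) := by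
    gcongr
    have : 0 ≤ R ^ 2 + 2 * √h * R := by positivity
    linarith
  calc 1 / 4 * min K (2 * c₀ / (R ^ 2 + 2 * √h * R + 12 * h)) * h
      ≤ 1 / 4 * (2 * c₀ / (12 * h)) * h := by
        gcongr
        exact (min_le_right _ _).trans h1
    _ = c₀ / 24 := by field_simp; norm_num

lemma metricConst_le_p₀ (ha : 0 < a) : metricConst R h a ≤ p₀ / 2 := by
  rw [metricConst, if_neg ha.ne']
  exact min_le_left _ _

lemma c₁_mul_le_one (ha : 0 ≤ a) (hh : 0 < h) (hR : 0 < R) : c₁ K R h a * h ≤ 1 := by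
  have h1 := p₀_le_one
  have h2 := c₀_le_p₀
  rcases ha.eq_or_lt with rfl | ha
  · linarith [c₁_zero_mul_le (K := K) hh hR]
  · linarith [c₁_mul_le_metricConst (K := K) ha.le hh hR, metricConst_le_p₀ (R := R) (h := h) ha]

lemma c₁_nonneg (hK : 0 ≤ K) (ha : 0 ≤ a) (hh : 0 < h) (hR : 0 < R) : 0 ≤ c₁ K R h a := by
  have hc := c₀_pos
  have hp := p₀_pos
  unfold c₁
  split_ifs <;> positivity

/-- For `r ≥ R` the jump is absorbed through `a + r ≤ (1 + a/R) r`. -/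
lemma c₁_mul_add_le (hK : 0 ≤ K) (ha : 0 ≤ a) (hR : 0 < R) (hr : R ≤ r) :
    c₁ K R h a * (a + r) ≤ K * r / 4 := by
  have hr0 : 0 < r := hR.trans_le hr
  rcases ha.eq_or_lt with rfl | ha
  · rw [c₁, if_pos rfl, zero_add]
    have := mul_le_mul_of_nonneg_right
      (min_le_left K (2 * c₀ / (R ^ 2 + 2 * √h * R + 12 * h))) hr0.le
    linarith
  · rw [c₁, if_neg ha.ne']
    have h1 := mul_le_mul_of_nonneg_right (min_le_left (K / (1 + a / R))
      (min (2 * c₀ / (R ^ 2 + 2 * (a + √h) * R)) (2 * p₀ / h))) (show 0 ≤ a + r by positivity)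
    have h2 : K / (1 + a / R) * (a + r) ≤ K * r := by
      rw [div_mul_eq_mul_div, div_le_iff₀ (by positivity), mul_assoc]
      apply mul_le_mul_of_nonneg_left _ hK
      have : a ≤ r * (a / R) := by
        rw [mul_div_assoc', le_div_iff₀ hR]
        nlinarith
      linarith
    linarith

/-- Contraction at distance less than `R`, in terms of the distance `t` before adding the noise. -/
lemma integral_rejProb_mul_le_of_lt (ha : a = 0 ∨ √h ≤ a) (hh : 0 < h) (hR : 0 < R)
    (ht : 0 ≤ t) (htR : t ≤ R) :
    a * ∫ z, rejProb (t / √h) z ∂(gaussianReal 0 1)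
      + ∫ z, rejProb (t / √h) z * profile (curvature R h a) (a + √h) R |t + 2 * √h * z|
          ∂(gaussianReal 0 1)
      ≤ (1 - c₁ K R h a * h) * (a + profile (curvature R h a) (a + √h) R t) := by
  have hσ : 0 < √h := Real.sqrt_pos.2 hh
  have hσ2 : √h ^ 2 = h := Real.sq_sqrt hh.le
  have ha0 : 0 ≤ a := ha.elim (fun h => h.ge) (fun h => hσ.le.trans h)
  have hc := c₀_pos
  have hp := p₀_pos
  have hM := curvature_pos ha0 hh hR
  have hMR := curvature_mul_le ha0 hh hR
  have hA : 0 ≤ a + √h := by positivity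
  have hFt := profile_le hM.le hA hR.le ht
  have hF0 := half_le_profile hM.le hA hR.le hMR ht
  have hcM := c₁_mul_le_metricConst (K := K) ha0 hh hR
  have hc0 := metricConst_pos ha0 hh hR
  have hcurv : curvature R h a * h * c₀ / 2 = metricConst R h a := by
    unfold curvature; field_simp
  have hQ := integral_one_sub_rejProb (t / √h)
  have hQ0 := integral_one_sub_rejProb_nonneg (t / √h)
  set c := metricConst R h a
  set F := profile (curvature R h a) (a + √h) R t
  set q := ∫ z, rejProb (t / √h) z ∂(gaussianReal 0 1)
  have hq : a * q ≤ a := by nlinarith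
  suffices H : a * q + ∫ z, rejProb (t / √h) z
      * profile (curvature R h a) (a + √h) R |t + 2 * √h * z| ∂(gaussianReal 0 1)
      ≤ (1 - c) * (a + F) ∨ a * q + ∫ z, rejProb (t / √h) z
      * profile (curvature R h a) (a + √h) R |t + 2 * √h * z| ∂(gaussianReal 0 1)
      ≤ a + F - c₁ K R h a * h * (a + F) by
    rcases H with H | H
    · exact H.trans (mul_le_mul_of_nonneg_right (by linarith) (by linarith))
    · linarith
  rcases le_or_gt (√h) t with htσ | htσ
  · left
    have h1 := integral_rejProb_mul_profile_le_of_le hM.le (show √h ≤ a + √h by linarith) hR.le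
      hMR hσ htσ htR
    have h2 : curvature R h a * (a + √h - √h + t) * √h ^ 2 / 2 * c₀ = c * (a + t) := by
      rw [hσ2, ← hcurv]; ring
    rw [h2] at h1
    nlinarith
  · have hp1 := p₀_le_integral_one_sub_rejProb (τ := t / √h) (by positivity)
      ((div_le_one hσ).2 htσ.le)
    rcases ha with rfl | ha
    · rcases le_or_gt (t + √h) R with hR1 | hR1
      · left
        have h1 := integral_rejProb_mul_profile_le_of_ge hM.le hA hR.le hMR hσ ht htσ.le hR1
        have h2 : c * t ≤ curvature R h 0 * (0 + √h + t) * √h ^ 2 / 2 * (c₀ * (t / √h)) := by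
          have : curvature R h 0 * (0 + √h + t) * √h ^ 2 / 2 * (c₀ * (t / √h))
              = c * t + c * t * (t / √h) := by
            rw [hσ2, ← hcurv]; field_simp; ring
          rw [this]
          have : 0 ≤ c * t * (t / √h) := by positivity
          linarith
        nlinarith
      -- Boundary layer `R - √h < t < √h`: outward moves may leave the curved region. It suffices to
      -- gain `p₀t/24`, since `c₁h ≤ c₀/24 ≤ p₀/24`.
      · right
        have hc24 := c₁_zero_mul_le (K := K) hh hR
        have hcp := c₀_le_p₀
        have h4 : c₁ K R h 0 * h * F ≤ p₀ / 24 * t :=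
          mul_le_mul (by linarith) hFt (by linarith) (by linarith)
        rcases le_total (2 * t) R with hR2 | hR2
        · have h1 := integral_rejProb_mul_profile_le_of_far hM.le hA
            (by rw [zero_add]; exact curvature_zero hh hR) hσ ht htσ.le hR2 hR1.le
          have : 0 ≤ p₀ * t := by positivity
          simp only [zero_mul, zero_add] at h1 ⊢
          simp only [F, zero_add] at h4 ⊢
          linarith
        · have h1 := integral_rejProb_mul_profile_le_of_mass hM.le hA hMR hσ ht htσ.le htR
          have h2 := curvature_zero hh hR
          -- From `R ≤ 2t` and `t < √h`. Hence `M √h t ≥ 1/8`, and merging gains at least `p₀t/16`.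
          have h3 : √h * R + R ^ 2 / 2 ≤ 4 * (√h * t) := by nlinarith
          have h5 : 1 / 8 ≤ curvature R h 0 * (√h * t) := by nlinarith
          have h6 := mul_le_mul_of_nonneg_right h5 (show 0 ≤ p₀ * t by positivity)
          have : 0 ≤ p₀ * t := by positivity
          simp only [zero_mul, zero_add] at h1 ⊢
          simp only [F, zero_add] at h4 ⊢
          nlinarith
    -- Merging saves `a p₀`, while `c ≤ p₀/2` and `f_a(t) ≤ t < √h ≤ a` give `c (a + f_a(t)) ≤ a
    -- p₀`.
    · left
      have ha1 : 0 < a := hσ.trans_le ha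
      have h1 := integral_rejProb_mul_profile_le_self hM.le hA hR.le hMR hσ ht
      have h2 := metricConst_le_p₀ (R := R) (h := h) ha1
      have h3 : a * q ≤ a * (1 - p₀) := mul_le_mul_of_nonneg_left (by linarith) ha0
      have h4 : c * (a + F) ≤ p₀ / 2 * (2 * a) :=
        mul_le_mul h2 (by linarith) (by linarith) (by positivity)
      linarith

/-- Contraction of the expected distance function, in terms of the distance `r` and the
distance `t` before adding the noise. -/
lemma integral_rejProb_mul_le (hK : 0 ≤ K) (ha : a = 0 ∨ √h ≤ a) (hh : 0 < h) (hR : 0 < R)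
    (ht : 0 ≤ t) (htr : t ≤ r) (hfar : R ≤ r → t ≤ (1 - h * K / 2) * r) :
    a * ∫ z, rejProb (t / √h) z ∂(gaussianReal 0 1)
      + ∫ z, rejProb (t / √h) z * profile (curvature R h a) (a + √h) R |t + 2 * √h * z|
          ∂(gaussianReal 0 1)
      ≤ (1 - c₁ K R h a * h) * (a + profile (curvature R h a) (a + √h) R r) := by
  have hσ : 0 < √h := Real.sqrt_pos.2 hh
  have ha0 : 0 ≤ a := ha.elim (fun h => h.ge) (fun h => hσ.le.trans h)
  have hM := (curvature_pos ha0 hh hR).le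
  have hMR := curvature_mul_le ha0 hh hR
  have hA : 0 ≤ a + √h := by positivity
  have hmono := half_sub_le_profile_sub hM hA hR.le hMR ht htr
  have h1 := c₁_mul_le_one (K := K) ha0 hh hR
  rcases lt_or_ge r R with hr | hr
  · refine (integral_rejProb_mul_le_of_lt (K := K) ha hh hR ht (htr.trans hr.le)).trans ?_
    apply mul_le_mul_of_nonneg_left _ (by linarith)
    linarith
  -- Noise does not increase the mean profile, and the drift lowers it by at least `(r - t)/2 ≥
  -- hKr/4`.
  · have h2 := integral_rejProb_mul_profile_le_self hM hA hR.le hMR hσ ht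
    have h3 := hfar hr
    have h4 := mul_le_mul_of_nonneg_left (c₁_mul_add_le (h := h) hK ha0 hR hr) hh.le
    have h5 := profile_le hM hA hR.le (ht.trans htr)
    have h6 := mul_le_mul_of_nonneg_left h5
      (mul_nonneg (c₁_nonneg (K := K) hK ha0 hh hR) hh.le)
    have hQ := integral_one_sub_rejProb (t / √h)
    have hQ0 := integral_one_sub_rejProb_nonneg (t / √h)
    have h7 : a * ∫ z, rejProb (t / √h) z ∂(gaussianReal 0 1) ≤ a * 1 :=
      mul_le_mul_of_nonneg_left (by linarith) ha0
    nlinarith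

end Rate

/-! ### Reduction of the coupling to one dimension -/

section Coupling

variable {d : ℕ} {b : E d → E d} {h : ℝ} {x y : E d}

lemma norm_unitDir (hxy : hat b h x ≠ hat b h y) : ‖unitDir b h x y‖ = 1 := by
  rw [unitDir, norm_smul, norm_inv, norm_norm]
  exact inv_mul_cancel₀ (norm_ne_zero_iff.2 (sub_ne_zero.2 hxy))

lemma norm_smul_unitDir (hxy : hat b h x ≠ hat b h y) :
    ‖hat b h x - hat b h y‖ • unitDir b h x y = hat b h x - hat b h y := by
  rw [unitDir, smul_inv_smul₀ (norm_ne_zero_iff.2 (sub_ne_zero.2 hxy))]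

/-- Normalizing factors and orthogonal noise cancel, so acceptance depends on `z` only through its
component along `ê`, whatever the dimension. -/
lemma gaussianDensity_div (hh : 0 < h) (hxy : hat b h x ≠ hat b h y) (z : E d) :
    gaussianDensity (hat b h y) h (stepX b h x z) / gaussianDensity (hat b h x) h (stepX b h x z)
      = Real.exp (-((‖hat b h x - hat b h y‖ / √h) ^ 2 / 2
        + ‖hat b h x - hat b h y‖ / √h * inner ℝ (unitDir b h x y) z)) := by
  have hpos : (2 * Real.pi * h) ^ (-(d : ℝ) / 2) ≠ 0 :=
    (Real.rpow_pos_of_pos (by positivity) _).ne'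
  have hσ : √h ≠ 0 := (Real.sqrt_pos.2 hh).ne'
  have hσ2 : √h ^ 2 = h := Real.sq_sqrt hh.le
  rw [gaussianDensity, gaussianDensity, mul_div_mul_left _ _ hpos, ← Real.exp_sub]
  congr 1
  have h1 : stepX b h x z - hat b h y = (hat b h x - hat b h y) + √h • z := by
    rw [stepX]; abel
  have h2 : stepX b h x z - hat b h x = √h • z := by
    rw [stepX]; abel
  have h3 : inner ℝ (hat b h x - hat b h y) (√h • z)
      = √h * (‖hat b h x - hat b h y‖ * inner ℝ (unitDir b h x y) z) := by
    conv_lhs => rw [real_inner_smul_right, ← norm_smul_unitDir hxy, real_inner_smul_left]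
  rw [h1, h2, norm_add_sq_real, h3]
  set t := ‖hat b h x - hat b h y‖
  set p : ℝ := inner ℝ (unitDir b h x y) z
  rw [div_pow, hσ2]
  have h4 : √h / h = 1 / √h := by
    rw [div_eq_div_iff hh.ne' hσ, one_mul, ← sq, hσ2]
  have h5 : t / √h * p = √h / h * (t * p) := by rw [h4]; ring
  rw [h5]
  field_simp
  ring

lemma stepX_sub_stepRefl (hxy : hat b h x ≠ hat b h y) (z : E d) :
    stepX b h x z - stepRefl b h x y z
      = (‖hat b h x - hat b h y‖ + 2 * √h * inner ℝ (unitDir b h x y) z) • unitDir b h x y := by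
  rw [add_smul, norm_smul_unitDir hxy, stepX, stepRefl]
  module

lemma rho_self (R h a : ℝ) (x : E d) : rho R h a x x = 0 := by
  simp [rho, jump, f]

/-- The distance after a coupled step as a function of the noise `z` in the direction of
reflection and of the uniform variable `u`. -/
def coupledDist (τ : ℝ) (k : ℝ → ℝ) (q : ℝ × ℝ) : ℝ :=
  if q.2 ≤ Real.exp (-(τ ^ 2 / 2 + τ * q.1)) then 0 else k q.1

lemma rho_step_eq {R a : ℝ} (ha : 0 ≤ a) (hR : 0 < R) (hh : 0 < h)
    (hxy : hat b h x ≠ hat b h y) (z : E d) {u : ℝ} (hu : u < 1) :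
    rho R h a (stepX b h x z) (stepY b h x y z u)
      = coupledDist (‖hat b h x - hat b h y‖ / √h)
        (fun p => a + profile (curvature R h a) (a + √h) R |‖hat b h x - hat b h y‖ + 2 * √h * p|)
        (inner ℝ (unitDir b h x y) z, u) := by
  have ht : 0 < ‖hat b h x - hat b h y‖ := norm_pos_iff.2 (sub_ne_zero.2 hxy)
  have hσ : 0 < √h := Real.sqrt_pos.2 hh
  rw [stepY, gaussianDensity_div hh hxy, coupledDist]
  simp only
  split_ifs with hacc
  · exact rho_self _ _ _ _
  · have hnorm : ‖stepX b h x z - stepRefl b h x y z‖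
        = |‖hat b h x - hat b h y‖ + 2 * √h * inner ℝ (unitDir b h x y) z| := by
      rw [stepX_sub_stepRefl hxy, norm_smul, norm_unitDir hxy, mul_one, Real.norm_eq_abs]
    -- If the reflected copies coincided, the density ratio would be `1` and `u < 1` would have been
    -- accepted. So rejection always costs the full jump `a`.
    have hne : stepX b h x z ≠ stepRefl b h x y z := by
      intro heq
      rw [heq, sub_self, norm_zero, eq_comm, abs_eq_zero] at hnorm
      apply hacc
      set t := ‖hat b h x - hat b h y‖
      set p : ℝ := inner ℝ (unitDir b h x y) z
      have hz : (t / √h) ^ 2 / 2 + t / √h * p = 0 := by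
        have : (t / √h) ^ 2 / 2 + t / √h * p = t / √h ^ 2 / 2 * (t + 2 * √h * p) := by
          field_simp
        rw [this, hnorm, mul_zero]
      rw [hz, neg_zero, Real.exp_zero]
      exact hu.le
    rw [rho, jump, if_pos hne, f_eq_profile ha hh hR (norm_nonneg _), hnorm]

lemma measurable_coupledDist (τ : ℝ) {k : ℝ → ℝ} (hk : Measurable k) :
    Measurable (coupledDist τ k) := by
  unfold coupledDist
  refine Measurable.ite (measurableSet_le measurable_snd ?_) measurable_const
    (hk.comp measurable_fst)
  fun_prop

instance : IsProbabilityMeasure (volume.restrict (Set.Ioo (0 : ℝ) 1)) :=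
  ⟨by simp⟩

lemma integrable_coupledDist (τ : ℝ) {k : ℝ → ℝ} (hk : Measurable k)
    (hki : Integrable k (gaussianReal 0 1)) :
    Integrable (coupledDist τ k) ((gaussianReal 0 1).prod (volume.restrict (Set.Ioo 0 1))) := by
  refine (hki.comp_fst _).mono (measurable_coupledDist τ hk).aestronglyMeasurable
    (Filter.Eventually.of_forall fun q => ?_)
  unfold coupledDist
  split_ifs <;> simp

/-- Integrating out `u` first leaves the length of the part of `(0, 1)` above the acceptance
threshold, which is `rejProb`. -/
lemma integral_coupledDist (τ : ℝ) {k : ℝ → ℝ} (hk : Measurable k)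
    (hki : Integrable k (gaussianReal 0 1)) :
    ∫ q, coupledDist τ k q ∂((gaussianReal 0 1).prod (volume.restrict (Set.Ioo 0 1)))
      = ∫ z, rejProb τ z * k z ∂(gaussianReal 0 1) := by
  rw [integral_prod _ (integrable_coupledDist τ hk hki)]
  congr 1 with z
  have h1 : (fun u => coupledDist τ k (z, u))
      = (Set.Ioi (Real.exp (-(τ ^ 2 / 2 + τ * z)))).indicator fun _ => k z := by
    ext u
    by_cases hu : u ≤ Real.exp (-(τ ^ 2 / 2 + τ * z))
    · rw [Set.indicator_of_notMem (by exact hu.not_gt)]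
      exact if_pos hu
    · rw [Set.indicator_of_mem (Set.mem_Ioi.2 (not_le.1 hu))]
      exact if_neg hu
  have h2 : Set.Ioi (Real.exp (-(τ ^ 2 / 2 + τ * z))) ∩ Set.Ioo (0 : ℝ) 1
      = Set.Ioo (Real.exp (-(τ ^ 2 / 2 + τ * z))) 1 := by
    ext u
    have := Real.exp_pos (-(τ ^ 2 / 2 + τ * z))
    simp only [Set.mem_inter_iff, Set.mem_Ioi, Set.mem_Ioo]
    exact ⟨fun hu => ⟨hu.1, hu.2.2⟩, fun hu => ⟨hu.1, this.trans hu.1, hu.2⟩⟩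
  rw [h1, integral_indicator_const _ measurableSet_Ioi,
    measureReal_restrict_apply measurableSet_Ioi, h2, Measure.real, Real.volume_Ioo,
    ENNReal.toReal_ofReal', max_comm]
  rfl

variable {Ω : Type*} [MeasurableSpace Ω] {P : Measure Ω} {Z : Ω → E d} {U : Ω → ℝ}

lemma hasLaw_inner (hZ : HasLaw Z (stdGaussian (E d)) P) {e : E d} (he : ‖e‖ = 1) :
    HasLaw (fun ω => inner ℝ e (Z ω)) (gaussianReal 0 1) P := by
  have h1 : HasLaw (innerSL ℝ e) (gaussianReal 0 1) (stdGaussian (E d)) := by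
    refine ⟨by fun_prop, ?_⟩
    rw [IsGaussian.map_eq_gaussianReal, integral_strongDual_stdGaussian,
      variance_dual_stdGaussian, innerSL_apply_norm, he]
    simp
  exact h1.comp hZ

lemma hasLaw_uniform (hU : pdf.IsUniform U (Set.Ioo (0 : ℝ) 1) P volume) :
    HasLaw U (volume.restrict (Set.Ioo (0 : ℝ) 1)) P := by
  refine ⟨hU.aemeasurable (by simp) (by simp), ?_⟩
  rw [hU, ProbabilityTheory.cond]
  simp

lemma ae_uniform_lt_one (hU : HasLaw U (volume.restrict (Set.Ioo (0 : ℝ) 1)) P) :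
    ∀ᵐ ω ∂P, U ω < 1 := by
  have h1 : ∀ᵐ u ∂(volume.restrict (Set.Ioo (0 : ℝ) 1)), u < 1 := by
    filter_upwards [ae_restrict_mem measurableSet_Ioo] with u hu using hu.2
  rw [← hU.map_eq] at h1
  exact ae_of_ae_map hU.aemeasurable h1

lemma rho_step_eq_zero {R a : ℝ} (hxy : hat b h x = hat b h y) (z : E d) {u : ℝ}
    (hh : 0 < h) (hu : u < 1) : rho R h a (stepX b h x z) (stepY b h x y z u) = 0 := by
  have hpos : gaussianDensity (hat b h y) h (stepX b h x z) ≠ 0 := by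
    unfold gaussianDensity
    have := Real.rpow_pos_of_pos (show 0 < 2 * Real.pi * h by positivity) (-(d : ℝ) / 2)
    positivity
  rw [stepY, hxy, div_self hpos, if_pos hu.le]
  exact rho_self _ _ _ _

lemma integrable_rho_step [IsProbabilityMeasure P] {R a : ℝ} (ha : 0 ≤ a) (hR : 0 < R)
    (hh : 0 < h) (hxy : hat b h x ≠ hat b h y) (hZ : HasLaw Z (stdGaussian (E d)) P)
    (hU : HasLaw U (volume.restrict (Set.Ioo (0 : ℝ) 1)) P) (hZU : IndepFun Z U P) :
    Integrable (fun ω => rho R h a (stepX b h x (Z ω)) (stepY b h x y (Z ω) (U ω))) P ∧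
    ∫ ω, rho R h a (stepX b h x (Z ω)) (stepY b h x y (Z ω) (U ω)) ∂P
      = a * ∫ z, rejProb (‖hat b h x - hat b h y‖ / √h) z ∂(gaussianReal 0 1)
      + ∫ z, rejProb (‖hat b h x - hat b h y‖ / √h) z * profile (curvature R h a) (a + √h) R
          |‖hat b h x - hat b h y‖ + 2 * √h * z| ∂(gaussianReal 0 1) := by
  set t := ‖hat b h x - hat b h y‖ with ht
  have hM := (curvature_pos ha hh hR).le
  have hMR := curvature_mul_le ha hh hR
  have hpi := integrable_abs_profile hM (by positivity : 0 ≤ a + √h) hR.le hMR (√h) t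
  set k : ℝ → ℝ := fun p => a + profile (curvature R h a) (a + √h) R |t + 2 * √h * p| with hk
  have hkm : Measurable k := Continuous.measurable (by fun_prop)
  have hki : Integrable k (gaussianReal 0 1) := (integrable_const a).add hpi
  have hind : IndepFun (fun ω => inner ℝ (unitDir b h x y) (Z ω)) U P :=
    hZU.comp (φ := fun z => inner ℝ (unitDir b h x y) z) (ψ := id) (by fun_prop) measurable_id
  have hlaw := (indepFun_iff_hasLaw_prodMk_prod (hasLaw_inner hZ (norm_unitDir hxy)) hU).1 hind
  have hae : (fun ω => rho R h a (stepX b h x (Z ω)) (stepY b h x y (Z ω) (U ω)))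
      =ᵐ[P] coupledDist (t / √h) k ∘ fun ω => (inner ℝ (unitDir b h x y) (Z ω), U ω) := by
    filter_upwards [ae_uniform_lt_one hU] with ω hω
    exact rho_step_eq ha hR hh hxy _ hω
  constructor
  · rw [integrable_congr hae, ← integrable_map_measure _ hlaw.aemeasurable, hlaw.map_eq]
    · exact integrable_coupledDist _ hkm hki
    · exact (measurable_coupledDist _ hkm).aestronglyMeasurable
  · rw [integral_congr_ae hae,
      hlaw.integral_comp (measurable_coupledDist _ hkm).aestronglyMeasurable,
      integral_coupledDist _ hkm hki, ← integral_const_mul,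
      ← integral_add ((integrable_rejProb _).const_mul a) (integrable_rejProb_mul _ hpi)]
    congr 1 with z
    simp only [hk]
    ring

/-- Expanding the square gives the factor `1 - 2hK + h²L² ≤ 1 - hK ≤ (1 - hK/2)²`. -/
lemma norm_hat_sub_le {K L : ℝ} (hh : 0 < h) (hLh : h * L ^ 2 ≤ K)
    (hne : x ≠ y) (C2 : inner ℝ (x - y) (b x - b y) ≤ -K * ‖x - y‖ ^ 2)
    (C3 : ‖b x - b y‖ ≤ L * ‖x - y‖) :
    ‖hat b h x - hat b h y‖ ≤ (1 - h * K / 2) * ‖x - y‖ := by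
  have hr : 0 < ‖x - y‖ := norm_pos_iff.2 (sub_ne_zero.2 hne)
  have h1 : hat b h x - hat b h y = (x - y) + h • (b x - b y) := by
    unfold hat; module
  have h2 : ‖hat b h x - hat b h y‖ ^ 2 ≤ (1 - h * K) * ‖x - y‖ ^ 2 := by
    rw [h1, norm_add_sq_real, real_inner_smul_right, norm_smul, Real.norm_of_nonneg hh.le, mul_pow]
    have h3 : ‖b x - b y‖ ^ 2 ≤ (L * ‖x - y‖) ^ 2 := pow_le_pow_left₀ (norm_nonneg _) C3 2
    have h4 := mul_le_mul_of_nonneg_left h3 (sq_nonneg h)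
    have h5 := mul_le_mul_of_nonneg_right hLh (show 0 ≤ h * ‖x - y‖ ^ 2 by positivity)
    have h6 := mul_le_mul_of_nonneg_left C2 hh.le
    linarith
  -- Forced by `h2`, whose left side is a square, as `‖x - y‖ > 0`.
  have h7 : 0 ≤ 1 - h * K :=
    nonneg_of_mul_nonneg_left ((sq_nonneg _).trans h2) (by positivity)
  have h8 : 0 ≤ 1 - h * K / 2 := by nlinarith
  refine (sq_le_sq₀ (norm_nonneg _) (by positivity)).1 (h2.trans ?_)
  rw [mul_pow]
  gcongr
  nlinarith [sq_nonneg (h * K)]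

end Coupling

end EulerScheme

end
-- Assembly
theorem mainTheorem6 {d : ℕ} (b : EulerScheme.E d → EulerScheme.E d) (J K L R h a : ℝ)
    (hJ : 0 ≤ J) (hK : 0 < K) (hL : 0 < L) (hR : 0 < R) (hh : 0 < h)
    (C1 : ∀ x y, inner ℝ (x - y) (b x - b y) ≤ J * ‖x - y‖ ^ 2)
    (C2 : ∀ x y, R ≤ ‖x - y‖ → inner ℝ (x - y) (b x - b y) ≤ -K * ‖x - y‖ ^ 2)
    (C3 : ∀ x y, ‖b x - b y‖ ≤ L * ‖x - y‖)
    (hcontr : ∀ x y, ‖EulerScheme.hat b h x - EulerScheme.hat b h y‖ ≤ ‖x - y‖)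
    (ha : a = 0 ∨ √h ≤ a)
    {Ω : Type*} [MeasurableSpace Ω] (P : Measure Ω) [IsProbabilityMeasure P]
    (Z : Ω → EulerScheme.E d) (U : Ω → ℝ)
    (hZ : HasLaw Z (stdGaussian (EulerScheme.E d)) P)
    (hU : pdf.IsUniform U (Set.Ioo (0 : ℝ) 1) P volume)
    (hZU : IndepFun Z U P) :
    (EulerScheme.g R h a 0 = 1 ∧
      ∀ s ∈ Set.Icc 0 R, EulerScheme.g R h a s ∈ Set.Icc (1 / 2 : ℝ) 1) ∧
    (∀ x y : EulerScheme.E d,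
      EulerScheme.jump a x y + ‖x - y‖ / 2 ≤ EulerScheme.rho R h a x y ∧
      EulerScheme.rho R h a x y ≤ EulerScheme.jump a x y + ‖x - y‖) ∧
    (h < 1 / L * min (K / L) (1 / 2) →
      ∀ x y : EulerScheme.E d,
        Integrable (fun ω => EulerScheme.rho R h a (EulerScheme.stepX b h x (Z ω))
          (EulerScheme.stepY b h x y (Z ω) (U ω))) P ∧
        ∫ ω, EulerScheme.rho R h a (EulerScheme.stepX b h x (Z ω))
            (EulerScheme.stepY b h x y (Z ω) (U ω)) ∂P ≤
          (1 - EulerScheme.c₁ K R h a * h) * EulerScheme.rho R h a x y) := by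
  have ha0 : 0 ≤ a := ha.elim (fun h => h.ge) (fun h => (Real.sqrt_nonneg _).trans h)
  have hM := (EulerScheme.curvature_pos ha0 hh hR).le
  have hMR := EulerScheme.curvature_mul_le ha0 hh hR
  have hA : 0 ≤ a + √h := by positivity
  have hrho : ∀ x y : EulerScheme.E d,
      EulerScheme.jump a x y + ‖x - y‖ / 2 ≤ EulerScheme.rho R h a x y ∧
      EulerScheme.rho R h a x y ≤ EulerScheme.jump a x y + ‖x - y‖ := by
    intro x y
    rw [EulerScheme.rho, EulerScheme.f_eq_profile ha0 hh hR (norm_nonneg _)]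
    have h1 := EulerScheme.half_le_profile hM hA hR.le hMR (norm_nonneg (x - y))
    have h2 := EulerScheme.profile_le hM hA hR.le (norm_nonneg (x - y))
    constructor <;> linarith
  refine ⟨⟨by simp [EulerScheme.g], fun s hs => ?_⟩, hrho, fun hlt x y => ?_⟩
  · rw [EulerScheme.g_eq_slope ha0 hh hs.1]
    exact ⟨EulerScheme.half_le_slope hM hA hMR hs.1 hs.2, EulerScheme.slope_le_one hM hA hs.1⟩
  have hU' := EulerScheme.hasLaw_uniform hU
  -- If `x̂ = ŷ`, the density ratio is `1` and the copies merge almost surely, possibly from `x ≠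
  -- y`; only `c₁h ≤ 1` and `ρ_a ≥ 0` are then needed.
  by_cases hxy : EulerScheme.hat b h x = EulerScheme.hat b h y
  · have hae : (fun ω => EulerScheme.rho R h a (EulerScheme.stepX b h x (Z ω))
        (EulerScheme.stepY b h x y (Z ω) (U ω))) =ᵐ[P] fun _ => 0 := by
      filter_upwards [EulerScheme.ae_uniform_lt_one hU'] with ω hω
      exact EulerScheme.rho_step_eq_zero hxy _ hh hω
    rw [integrable_congr hae, integral_congr_ae hae, integral_zero]
    refine ⟨integrable_zero _ _ _, mul_nonneg ?_ ?_⟩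
    · linarith [EulerScheme.c₁_mul_le_one (K := K) ha0 hh hR]
    · have : 0 ≤ EulerScheme.jump a x y := by
        unfold EulerScheme.jump; split_ifs <;> simp [ha0]
      linarith [(hrho x y).1, norm_nonneg (x - y)]
  · have hne : x ≠ y := fun heq => hxy (heq ▸ rfl)
    obtain ⟨h1, h2⟩ := EulerScheme.integrable_rho_step ha0 hR hh hxy hZ hU' hZU
    refine ⟨h1, h2.trans_le ?_⟩
    rw [EulerScheme.rho, EulerScheme.jump, if_pos hne,
      EulerScheme.f_eq_profile ha0 hh hR (norm_nonneg _)]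
    have hLh : h * L ^ 2 ≤ K := by
      have h3 : h < 1 / L * (K / L) :=
        hlt.trans_le (mul_le_mul_of_nonneg_left (min_le_left _ _) (by positivity))
      rw [one_div, inv_mul_eq_div, div_div, ← sq, lt_div_iff₀ (by positivity)] at h3
      exact h3.le
    exact EulerScheme.integral_rejProb_mul_le hK.le ha hh hR (norm_nonneg _) (hcontr x y)
      fun hr => EulerScheme.norm_hat_sub_le hh hLh hne (C2 x y hr) (C3 x y)
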